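/- Let $-\infty<a<b<\infty$ and let $\mu$ be a continuous (i.e. atomless) self-similar probability measure on $\mathbb R$ with $\operatorname{supp}\mu=[a,b]$: $\mu=\sum_{i=1}^q p_i\,\mu\circ S_i^{-1}$ with contractive similitudes $S_i(x)=s_ix+c_i$, $0<|s_i|<1$, and weights $p_i>0$, $\sum_i p_i=1$. Let $T_j(x)=r^{n_j}x+d_j$ $(1\le j\le N)$ with $0<r<1$, integers $n_j\ge 1$, $d_j\in\mathbb R$, and put $\rho:=\max_j r^{n_j}$. Assume that $\{T_j\}$ satisfies the open set condition and that $\mu$ satisfies second-order self-similar identities with respect to $\{T_j\}$: $\operatorname{supp}\mu\subseteq\bigcup_jT_j(\operatorname{supp}\mu)$, and for all $i,j$ there are $e_1,\dots,e_N\in\mathbb R$ such that $\mu(T_iT_jA)=\sum_{k}e_k\,\mu(T_kA)$ for every Borel set $A\subseteq\operatorname{supp}\mu$. Let $\mathcal E(v,w)=\int_a^b v'w'\,dx$ for $v,w\in H^1_0(a,b)$, let $\operatorname{Dom}\mathcal E$ be the orthogonal complement in $H_0^1(a,b)$ of the subspace of those $v$ whose continuous representative vanishes $\mu$-a.e.,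 and put $\|v\|_{\operatorname{Dom}\mathcal E}=\mathcal E(v,v)^{1/2}$. Let $(\cdot,\cdot)_\mu$ and $\|\cdot\|_\mu$ be the inner product and norm of $L^2_\mu[a,b]$, and use the embeddings $\operatorname{Dom}\mathcal E\hookrightarrow L^2_\mu[a,b]\hookrightarrow(\operatorname{Dom}\mathcal E)'$, the second being $w\mapsto(w,\cdot)_\mu$. Elements of $\operatorname{Dom}\mathcal E$ are identified with their continuous representatives. For $T>0$ and $g,h\in\operatorname{Dom}\mathcal E$, a weak solution of $u_{tt}-\Delta_\mu u=0$ on $[a,b]\times[0,T]$ with $u=0$ on $\{a,b\}\times[0,T]$, $u(\cdot,0)=g$, $u_t(\cdot,0)=h$, is a function $u\in L^2(0,T;\operatorname{Dom}\mathcal E)$ with weak time derivatives $u_t\in L^2(0,T;L^2_\mu[a,b])$ and $u_{tt}\in L^2(0,T;(\operatorname{Dom}\mathcal E)')$ such that for every $v\in\operatorname{Dom}\mathcal E$ one has $\langle u_{tt},v\rangle+\mathcal E(u,v)=0$ for a.e. $t\in[0,T]$, and $u(0)=g$, $u_t(0)=h$; here $u$ and $u_t$ denote the representatives that are continuous on $[0,T]$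 with values in $L^2_\mu[a,b]$ and $(\operatorname{Dom}\mathcal E)'$ respectively. For $m\ge1$ let $V_m=\{x_0<x_1<\dots<x_{N^m}\}$, $x_0=a$, $x_{N^m}=b$, be the set of end-points of the intervals $T_{j_1}\circ\cdots\circ T_{j_m}([a,b])$, $1\le j_1,\dots,j_m\le N$, and for $1\le i\le N^m-1$ let $\phi_i$ be the tent function: continuous, affine on each $[x_{k-1},x_k]$, with $\phi_i(x_k)=\delta_{ik}$. Put $\mathcal P_mv=\sum_{i=1}^{N^m-1}v(x_i)\phi_i$ for $v\in\operatorname{Dom}\mathcal E$. Let $u^m(x,t)=\sum_{j=1}^{N^m-1}\beta_j(t)\phi_j(x)$ be the finite element approximation on $[0,T]$, i.e. for $1\le i\le N^m-1$ and $t\in[0,T]$ $$\sum_{j}\beta_j''(t)\int_a^b\phi_i\phi_j\,d\mu=-\sum_j\beta_j(t)\int_a^b\phi_i'\phi_j'\,dx,\qquad \beta_i(0)=g(x_i),\quad \beta_i'(0)=h(x_i).$$ Then there is a constant $C>0$, independent of $T$, $g$, $h$, $u$, $m$ and $t$, such that for all $T>0$, all $g,h\in\operatorname{Dom}\mathcal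 E$, the weak solution $u$, all $m\ge1$ and all $t\in[0,T]$, $$\|\mathcal P_mu(\cdot,t)-u^m(\cdot,t)\|_\mu\le C\sqrt T\,\rho^{m/2}\,\Big(\int_0^T\|u_{tt}(s)\|_{\operatorname{Dom}\mathcal E}^2\,ds\Big)^{1/2},$$ where the right-hand side is understood as $+\infty$ if $u_{tt}\notin L^2(0,T;\operatorname{Dom}\mathcal E)$. -/

import Mathlib

open MeasureTheory Set Filter Topology
open scoped ContDiff BoundedContinuousFunction

namespace FractalWave

noncomputable section

/-! ### The Sobolev space `H₀¹(a,b)` -/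

/-- `C_c^∞(a,b)`, as functions on `ℝ` supported in `(a,b)`. -/
def IsTest (a b : ℝ) (φ : ℝ → ℝ) : Prop :=
  ContDiff ℝ ∞ φ ∧ HasCompactSupport φ ∧ tsupport φ ⊆ Ioo a b

/-- The Lebesgue space `L²(a,b)`. -/
abbrev L2 (a b : ℝ) : Type := Lp ℝ 2 (volume.restrict (Ioo a b))

/-- `L²(a,b) × L²(a,b)` with the Hilbert norm. A function `u` of `H¹(a,b)` is recorded as the pair
`(u, u')` of `u` and its weak derivative, so the inner product is `∫ u v + ∫ u' v'`, that of
`H¹(a,b)`. -/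
abbrev PairSpace (a b : ℝ) : Type := WithLp 2 (L2 a b × L2 a b)

/-- `H₀¹(a,b)`: the closure of `C_c^∞(a,b)` (which is its own span) in the norm of `H¹(a,b)`. -/
def H01Submodule (a b : ℝ) : Submodule ℝ (PairSpace a b) :=
  (Submodule.span ℝ {w : PairSpace a b | ∃ φ : ℝ → ℝ, IsTest a b φ ∧
    (w.fst : ℝ → ℝ) =ᵐ[volume.restrict (Ioo a b)] φ ∧
    (w.snd : ℝ → ℝ) =ᵐ[volume.restrict (Ioo a b)] deriv φ}).topologicalClosure

/-- `H₀¹(a,b)` as a Hilbert space with the inner product of `H¹(a,b)`. -/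
abbrev H01 (a b : ℝ) : Type := ↥(H01Submodule a b)

/-- The weak derivative `u'`. -/
def weakDeriv {a b : ℝ} (u : H01 a b) : L2 a b := (u : PairSpace a b).snd

/-- The quadratic form `E(u,v) = ∫_a^b u' v' dx`. -/
def energy {a b : ℝ} (u v : H01 a b) : ℝ :=
  ∫ x in Ioo a b, weakDeriv u x * weakDeriv v x

/-- The energy norm `‖u‖ = E(u,u)^{1/2}`. -/
def energyNorm {a b : ℝ} (u : H01 a b) : ℝ := Real.sqrt (energy u u)

theorem intervalIntegrable_L2 {a b : ℝ} (p : L2 a b) (x y : ℝ) :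
    IntervalIntegrable p (volume.restrict (Ioo a b)) x y :=
  ((Lp.memLp p).integrable (by norm_num)).intervalIntegrable

theorem abs_primitive_le {a b : ℝ} (p : L2 a b) (x : ℝ) :
    ‖∫ t in a..x, p t ∂(volume.restrict (Ioo a b))‖
      ≤ Real.sqrt ((volume.restrict (Ioo a b)).real univ) * ‖p‖ := by
  rw [intervalIntegral.norm_integral_eq_norm_integral_uIoc]
  have hs : MeasurableSet (uIoc a x) := measurableSet_uIoc
  have hne : (volume.restrict (Ioo a b)) (uIoc a x) ≠ ⊤ := measure_ne_top _ _
  rw [← L2.inner_indicatorConstLp_one (𝕜 := ℝ) hs hne p]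
  refine (norm_inner_le_norm _ _).trans ?_
  gcongr
  rw [norm_indicatorConstLp (by norm_num) (by norm_num), norm_one, one_mul, Real.sqrt_eq_rpow]
  norm_num
  refine Real.rpow_le_rpow measureReal_nonneg ?_ (by norm_num)
  have := measureReal_mono (μ := volume.restrict (Ioo a b)) (subset_univ (uIoc a x))
  simpa using this

/-- `p ↦ (x ↦ ∫_a^x p)`, as a bounded linear map into the bounded continuous functions on `ℝ`
(`p` is extended by `0` outside `(a,b)`). -/
def primitive (a b : ℝ) : L2 a b →L[ℝ] (ℝ →ᵇ ℝ) :=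
  LinearMap.mkContinuous
    { toFun := fun p => BoundedContinuousFunction.ofNormedAddCommGroup
        (fun x => ∫ t in a..x, p t ∂(volume.restrict (Ioo a b)))
        (intervalIntegral.continuous_primitive (intervalIntegrable_L2 p) a)
        (Real.sqrt ((volume.restrict (Ioo a b)).real univ) * ‖p‖) (abs_primitive_le p)
      map_add' := by
        intro p q
        ext x
        simp only [BoundedContinuousFunction.coe_ofNormedAddCommGroup,
          BoundedContinuousFunction.coe_add, Pi.add_apply]
        rw [← intervalIntegral.integral_add (intervalIntegrable_L2 p a x)
          (intervalIntegrable_L2 q a x)]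
        refine intervalIntegral.integral_congr_ae_restrict ?_
        filter_upwards [ae_restrict_of_ae (Lp.coeFn_add p q)] with t ht
        simpa using ht
      map_smul' := by
        intro c p
        ext x
        simp only [BoundedContinuousFunction.coe_ofNormedAddCommGroup,
          BoundedContinuousFunction.coe_smul, RingHom.id_apply]
        rw [← intervalIntegral.integral_smul]
        refine intervalIntegral.integral_congr_ae_restrict ?_
        filter_upwards [ae_restrict_of_ae (Lp.coeFn_smul c p)] with t ht
        simpa using ht }
    (Real.sqrt ((volume.restrict (Ioo a b)).real univ))
    (fun p => BoundedContinuousFunction.norm_ofNormedAddCommGroup_le _ (by positivity)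
      (abs_primitive_le p))

/-- The continuous representative `u_c` of `u ∈ H₀¹(a,b)`: `u_c(x) = ∫_a^x u'`. It depends linearly
and continuously on `u`; it is equal to `u` almost everywhere by `contRep_ae_eq`. -/
def contRep (a b : ℝ) : H01 a b →L[ℝ] (ℝ →ᵇ ℝ) :=
  (primitive a b).comp
    ((WithLp.sndL 2 ℝ (L2 a b) (L2 a b)).comp (H01Submodule a b).subtypeL)

theorem contRep_apply {a b : ℝ} (u : H01 a b) (x : ℝ) :
    contRep a b u x = ∫ t in a..x, weakDeriv u t ∂(volume.restrict (Ioo a b)) := rfl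

theorem contRep_ae_eq {a b : ℝ} (u : H01 a b) :
    (contRep a b u : ℝ → ℝ) =ᵐ[volume.restrict (Ioo a b)] ((u : PairSpace a b).fst : ℝ → ℝ) := by
  let P : PairSpace a b →L[ℝ] L2 a b :=
    (BoundedContinuousFunction.toLp 2 (volume.restrict (Ioo a b)) ℝ).comp
      ((primitive a b).comp (WithLp.sndL 2 ℝ (L2 a b) (L2 a b)))
  let D : PairSpace a b →L[ℝ] L2 a b := P - WithLp.fstL 2 ℝ (L2 a b) (L2 a b)
  have hle : H01Submodule a b ≤ D.ker := by
    refine Submodule.topologicalClosure_minimal _ (Submodule.span_le.2 ?_) D.isClosed_ker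
    rintro w ⟨φ, ⟨hφ, -, hsupp⟩, h1, h2⟩
    have hφa : φ a = 0 := image_eq_zero_of_notMem_tsupport (fun h => by simpa using hsupp h)
    change P w - w.fst = 0
    rw [sub_eq_zero]
    refine Lp.ext ?_
    refine (BoundedContinuousFunction.coeFn_toLp (p := 2) (𝕜 := ℝ) _ _).trans (EventuallyEq.trans ?_ h1.symm)
    refine (ae_restrict_iff' measurableSet_Ioo).2 (Eventually.of_forall fun x hx => ?_)
    change ∫ t in a..x, w.snd t ∂(volume.restrict (Ioo a b)) = φ x
    rw [intervalIntegral.integral_congr_ae_restrict (ae_restrict_of_ae h2),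
      intervalIntegral.integral_of_le hx.1.le, Measure.restrict_restrict measurableSet_Ioc,
      inter_eq_left.2 (show Ioc a x ⊆ Ioo a b from fun y hy => ⟨hy.1, hy.2.trans_lt hx.2⟩),
      ← intervalIntegral.integral_of_le hx.1.le]
    rw [intervalIntegral.integral_deriv_eq_sub
      (fun y _ => (hφ.differentiable (by simp)).differentiableAt)
      ((hφ.continuous_deriv (by simp)).intervalIntegrable _ _), hφa, sub_zero]
  have h0 : P u - (u : PairSpace a b).fst = 0 := hle u.2
  have h3 := BoundedContinuousFunction.coeFn_toLp (p := 2) (𝕜 := ℝ)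
    (μ := volume.restrict (Ioo a b)) (contRep a b u)
  have h4 : BoundedContinuousFunction.toLp 2 (volume.restrict (Ioo a b)) ℝ (contRep a b u)
    = (u : PairSpace a b).fst := sub_eq_zero.1 h0
  rw [h4] at h3
  exact h3.symm

/-! ### The domain of the form and the Gelfand triple `Dom E ↪ L²_μ ↪ (Dom E)'` -/

/-- The map `ι : H₀¹(a,b) → L²_μ[a,b]` that sends `u` to its `L²_μ`-representative, the class of
`u_c` (for `μ` with support in `[a,b]`, `L²_μ[a,b]` is `L²(ℝ, μ)`). -/
def iota (a b : ℝ) (μ : Measure ℝ) [IsFiniteMeasure μ] : H01 a b →L[ℝ] Lp ℝ 2 μ :=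
  (BoundedContinuousFunction.toLp 2 μ ℝ).comp (contRep a b)

/-- `Dom E = N^⊥`, the orthogonal complement in `H₀¹(a,b)` of `N = {u : ‖ι(u)‖_μ = 0}`. -/
def domSubmodule (a b : ℝ) (μ : Measure ℝ) [IsFiniteMeasure μ] : Submodule ℝ (H01 a b) :=
  ((iota a b μ).ker)ᗮ

/-- `Dom E` as a Hilbert space. -/
abbrev DomE (a b : ℝ) (μ : Measure ℝ) [IsFiniteMeasure μ] : Type := ↥(domSubmodule a b μ)

/-- The embedding `Dom E ↪ L²_μ`. -/
def embed (a b : ℝ) (μ : Measure ℝ) [IsFiniteMeasure μ] : DomE a b μ →L[ℝ] Lp ℝ 2 μ :=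
  (iota a b μ).comp (domSubmodule a b μ).subtypeL

/-- The embedding `L²_μ ↪ (Dom E)'`, `w ↦ (w, ·)_μ`. -/
def toDual {a b : ℝ} {μ : Measure ℝ} [IsFiniteMeasure μ] (w : Lp ℝ 2 μ) :
    StrongDual ℝ (DomE a b μ) :=
  (innerSL ℝ w).comp (embed a b μ)

/-! ### Functions of time and weak solutions -/

/-- `v ∈ L¹(0,T;X)` is the weak derivative of `u ∈ L¹(0,T;X)`. -/
def IsWeakTimeDeriv {X : Type*} [NormedAddCommGroup X] [NormedSpace ℝ X] (T : ℝ)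
    (u v : ℝ → X) : Prop :=
  IntegrableOn u (Ioo 0 T) ∧ IntegrableOn v (Ioo 0 T) ∧
    ∀ φ : ℝ → ℝ, IsTest 0 T φ →
      ∫ t in Ioo 0 T, deriv φ t • u t = -∫ t in Ioo 0 T, φ t • v t

/-- The norm of `ξ` in `L²(0,T;Dom E)` for a function `ξ` with values in `(Dom E)'`, where `Dom E`
carries the energy norm. It is `∞` if `ξ` is not in `L²(0,T;Dom E)`. The functions `w` below
represent `ξ` as a measurable function into `Dom E`; two of them agree almost everywhere, since
`Dom E → (Dom E)'` is injective. -/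
def normL2Dom {a b : ℝ} {μ : Measure ℝ} [IsFiniteMeasure μ] (T : ℝ)
    (ξ : ℝ → StrongDual ℝ (DomE a b μ)) : ENNReal :=
  ⨅ (w : ℝ → DomE a b μ)
    (_ : AEStronglyMeasurable w (volume.restrict (Ioo 0 T)))
    (_ : ∀ᵐ t ∂(volume.restrict (Ioo 0 T)), toDual (embed a b μ (w t)) = ξ t),
    eLpNorm (fun t => energyNorm (w t : H01 a b)) 2 (volume.restrict (Ioo 0 T))

/-- `u` is a weak solution on `[0,T]` of `u_tt - Δ_μ u = f` with zero boundary values, `u(0) = g`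
and `u_t(0) = h`; its weak time derivatives are `u₁ = u_t` and `u₂ = u_tt`. To make sense of the
initial conditions, `u` and `u_t` stand for the representatives that are continuous on `[0,T]` with
values in `L²_μ` and in `(Dom E)'`, respectively. -/
structure IsWeakSolution (a b : ℝ) (μ : Measure ℝ) [IsFiniteMeasure μ] (T : ℝ)
    (f : ℝ → DomE a b μ) (g : DomE a b μ) (h : Lp ℝ 2 μ)
    (u : ℝ → DomE a b μ) (u₁ : ℝ → Lp ℝ 2 μ) (u₂ : ℝ → StrongDual ℝ (DomE a b μ)) : Prop where
  memLp_u : MemLp u 2 (volume.restrict (Ioo 0 T))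
  memLp_ut : MemLp u₁ 2 (volume.restrict (Ioo 0 T))
  memLp_utt : MemLp u₂ 2 (volume.restrict (Ioo 0 T))
  deriv_u : IsWeakTimeDeriv T (fun t => embed a b μ (u t)) u₁
  deriv_ut : IsWeakTimeDeriv T (fun t => (toDual (u₁ t) : StrongDual ℝ (DomE a b μ))) u₂
  equation : ∀ v : DomE a b μ, ∀ᵐ t ∂(volume.restrict (Ioo 0 T)),
    u₂ t v + energy (u t : H01 a b) (v : H01 a b)
      = inner ℝ (embed a b μ (f t)) (embed a b μ v)
  continuousOn_u : ContinuousOn (fun t => embed a b μ (u t)) (Icc 0 T)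
  continuousOn_ut :
    ContinuousOn (fun t => (toDual (u₁ t) : StrongDual ℝ (DomE a b μ))) (Icc 0 T)
  initial_u : u 0 = g
  initial_ut : u₁ 0 = h

/-! ### Self-similar measures and second-order identities -/

/-- `μ` is the self-similar measure of the contractive similitudes `S_i(x) = s_i x + c_i` of `ℝ`
(`s_i = ±ρ_i`, `0 < ρ_i < 1`) with the probability weights `p_i`:
`μ = ∑ p_i μ ∘ S_i⁻¹`. -/
structure IsSelfSimilar {q : ℕ} (s c p : Fin q → ℝ) (μ : Measure ℝ) : Prop where
  isProbability : IsProbabilityMeasure μ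
  ratio : ∀ i, 0 < |s i| ∧ |s i| < 1
  weight_pos : ∀ i, 0 < p i
  weight_sum : ∑ i, p i = 1
  invariant : μ = ∑ i, ENNReal.ofReal (p i) • μ.map (fun x => s i * x + c i)

/-- The maps `T_j(x) = r^{n_j} x + d_j` of the auxiliary IFS. -/
def auxMap {N : ℕ} (r : ℝ) (n : Fin N → ℕ) (d : Fin N → ℝ) (j : Fin N) (x : ℝ) : ℝ :=
  r ^ n j * x + d j

/-- `μ` satisfies a family of second-order self-similar identities with respect to `(T_j)`. -/
structure SecondOrderIdentities {N : ℕ} (μ : Measure ℝ) (T : Fin N → ℝ → ℝ) : Prop where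
  support_subset : μ.support ⊆ ⋃ j, T j '' μ.support
  identity : ∀ i j, ∃ e : Fin N → ℝ, ∀ A : Set ℝ, MeasurableSet A → A ⊆ μ.support →
    μ.real (T i '' (T j '' A)) = ∑ k, e k * μ.real (T k '' A)

/-- The open set condition. -/
def OpenSetCondition {N : ℕ} (T : Fin N → ℝ → ℝ) : Prop :=
  ∃ U : Set ℝ, U.Nonempty ∧ Bornology.IsBounded U ∧ IsOpen U ∧ (⋃ j, T j '' U) ⊆ U ∧
    ∀ i j, i ≠ j → Disjoint (T i '' U) (T j '' U)

/-! ### The finite element method -/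

/-- `T_J = T_{j₁} ∘ ⋯ ∘ T_{j_m}` for a word `J = (j₁, …, j_m)`. -/
def wordMap {N : ℕ} (T : Fin N → ℝ → ℝ) {m : ℕ} (J : Fin m → Fin N) (x : ℝ) : ℝ :=
  (List.ofFn J).foldr (fun j y => T j y) x

/-- The set `V_m` of the end-points of the level-`m` intervals `T_J[a,b]`, `J ∈ {1,…,N}^m`, for
increasing maps `T_j`. -/
def nodeSet {N : ℕ} (T : Fin N → ℝ → ℝ) (a b : ℝ) (m : ℕ) : Finset ℝ :=
  Finset.univ.image (fun J : Fin m → Fin N => wordMap T J a) ∪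
    Finset.univ.image (fun J : Fin m → Fin N => wordMap T J b)

/-- The elements `x₀ < x₁ < ⋯ < x_n` of `V` in increasing order, `n + 1 = #V`. -/
def node (V : Finset ℝ) (i : ℕ) : ℝ := (V.sort (· ≤ ·)).getD i 0

/-- The indices `1, …, n - 1` of the interior nodes, where `n + 1 = #V` (`n = N^m` for `V_m`). -/
def interior (V : Finset ℝ) : Finset ℕ := Finset.Ico 1 (V.card - 1)

/-- The tent function `φ_j` at the interior node `x_j`. -/
def tent (V : Finset ℝ) (j : ℕ) (x : ℝ) : ℝ :=
  if node V (j - 1) ≤ x ∧ x ≤ node V j then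
    (x - node V (j - 1)) / (node V j - node V (j - 1))
  else if node V j ≤ x ∧ x ≤ node V (j + 1) then
    (x - node V (j + 1)) / (node V j - node V (j + 1))
  else 0

/-- The Rayleigh-Ritz projection `P_m v = ∑_{i=1}^{n-1} v(x_i) φ_i`. -/
def ritz (V : Finset ℝ) (v : ℝ → ℝ) (x : ℝ) : ℝ :=
  ∑ i ∈ interior V, v (node V i) * tent V i x

/-- The function `u^m(x,t) = ∑_{j=1}^{n-1} β_j(t) φ_j(x)`. -/
def femFun (V : Finset ℝ) (β : ℕ → ℝ → ℝ) (t x : ℝ) : ℝ :=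
  ∑ j ∈ interior V, β j t * tent V j x

/-- The coefficients `β_j`, `1 ≤ j ≤ n - 1`, solve on `[0,T]` the linear second-order system of the
finite element method for the homogeneous wave equation,
`∑_j β_j'' ∫ φ_i φ_j dμ = - ∑_j β_j ∫_a^b φ_i' φ_j' dx`, with `β_j(0) = g(x_j)` and
`β_j'(0) = h(x_j)`. -/
def IsFEMSolution (a b : ℝ) (μ : Measure ℝ) (T : ℝ) (V : Finset ℝ) (g h : ℝ → ℝ)
    (β : ℕ → ℝ → ℝ) : Prop :=
  ∃ β₁ β₂ : ℕ → ℝ → ℝ,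
    (∀ j ∈ interior V, ∀ t ∈ Icc 0 T, HasDerivWithinAt (β j) (β₁ j t) (Icc 0 T) t) ∧
    (∀ j ∈ interior V, ∀ t ∈ Icc 0 T, HasDerivWithinAt (β₁ j) (β₂ j t) (Icc 0 T) t) ∧
    (∀ i ∈ interior V, ∀ t ∈ Icc 0 T,
      ∑ j ∈ interior V, β₂ j t * (∫ x in Icc a b, tent V i x * tent V j x ∂μ)
        = -∑ j ∈ interior V, β j t * (∫ x in Icc a b, deriv (tent V i) x * deriv (tent V j) x)) ∧
    ∀ j ∈ interior V, β j 0 = g (node V j) ∧ β₁ j 0 = h (node V j)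

end

end FractalWave

open FractalWave

/-! In dimension one, nodal interpolation on a mesh is the orthogonal projection in the energy form:
pairing `v` with a tent function gives a second difference of the nodal values of `v`, so `v - P v`,
which vanishes at every node, is energy-orthogonal to all tents (`exists_H01_tent`,
`IsTentBasis.energy_proj`). Since μ has full support in `[a,b]`, no nonzero function of `H₀¹(a,b)`
vanishes μ-a.e.; hence `DomE` is all of `H₀¹(a,b)` and the tents are admissible test functions.

Write `e = P u - u^m`. Subtracting the finite element system from the weak equation tested with the
tents, the stiffness term of `u` becomes exactly that of `P u`. So `e` solves the discrete wave
equation with zero initial data and residual `R = P u_tt - u_tt`. The energy `‖e_t‖_μ² + E(e,e)` has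
derivative `2 (R, e_t)_μ`, and at its maximum this yields `E(e,e)^{1/2} ≤ 2 ∫ ‖R‖_μ`
(`energy_estimate`). On a cell of length at most `δ`, the interpolation error vanishes at the nodes
and is Hölder continuous of exponent 1/2, so `‖R‖_μ ≤ √δ ‖u_tt‖` (`abs_contRep_sub_proj_le`). The
open set condition and the covering of the support give `δ = ρ^m (b - a)` (`isMesh_nodeSet`).
Cauchy-Schwarz in time produces `√T`.

The nodal values of `u` must be differentiated twice in time, while the weak formulation controls
`u_t` only in `L²_μ`. When `u_tt` is represented by an integrable `w` with values in `DomE`, testing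
and the du Bois-Reymond lemma give `u = g + ∫ (h + ∫ w)` as a `DomE`-valued integral
(`eq_integral_of_isWeakTimeDeriv`), on which point evaluation acts. -/

namespace FractalWave

/-! ### Absolutely continuous functions on `[0,T]` -/

/-- On `[0,T]` the function `y` is a primitive of the integrable function `f`. -/
def IsPrimitive (T : ℝ) (y f : ℝ → ℝ) : Prop :=
  IntervalIntegrable f volume 0 T ∧ ∀ t ∈ Icc 0 T, y t = y 0 + ∫ s in (0 : ℝ)..t, f s

namespace IsPrimitive

variable {T : ℝ} {y z f g : ℝ → ℝ}

theorem intervalIntegrable_of_mem (hy : IsPrimitive T y f) {t : ℝ} (ht : t ∈ Icc 0 T) :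
    IntervalIntegrable f volume 0 t :=
  hy.1.mono_set (by
    rw [uIcc_of_le ht.1, uIcc_of_le (ht.1.trans ht.2)]; exact Icc_subset_Icc_right ht.2)

/-- `y` is controlled only on `[0,T]`, so the explicit primitive, defined on all of ℝ, takes its
place; this allows two-sided derivatives. -/
theorem absolutelyContinuous (hy : IsPrimitive T y f) :
    AbsolutelyContinuousOnInterval (fun t => y 0 + ∫ s in (0 : ℝ)..t, f s) 0 T := by
  have h1 := hy.1.absolutelyContinuousOnInterval_intervalIntegral (c := 0) (by simp)
  have h2 : AbsolutelyContinuousOnInterval (fun _ : ℝ => y 0) 0 T :=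
    (contDiffOn_const (n := 1)).absolutelyContinuousOnInterval
  exact h2.add h1

theorem continuousOn (hT : 0 ≤ T) (hy : IsPrimitive T y f) : ContinuousOn y (Icc 0 T) := by
  have h := (hy.absolutelyContinuous).continuousOn
  rw [uIcc_of_le hT] at h
  exact h.congr hy.2

theorem mul (hT : 0 ≤ T) (hy : IsPrimitive T y f) (hz : IsPrimitive T z g) :
    IsPrimitive T (fun t => y t * z t) (fun t => f t * z t + y t * g t) := by
  have hyc := hy.continuousOn hT
  have hzc := hz.continuousOn hT
  rw [← uIcc_of_le hT] at hyc hzc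
  refine ⟨(hy.1.mul_continuousOn hzc).add (hz.1.continuousOn_mul hyc), fun t ht => ?_⟩
  have hsub : uIcc 0 t ⊆ uIcc 0 T := by
    rw [uIcc_of_le ht.1, uIcc_of_le hT]; exact Icc_subset_Icc_right ht.2
  have key := ((hy.absolutelyContinuous).mono hsub).integral_deriv_mul_eq_sub
    ((hz.absolutelyContinuous).mono hsub)
  simp only [intervalIntegral.integral_same, add_zero] at key
  rw [← hy.2 t ht, ← hz.2 t ht] at key
  have : ∫ s in (0 : ℝ)..t, f s * z s + y s * g s = y t * z t - y 0 * z 0 := by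
    rw [← key]
    refine intervalIntegral.integral_congr_ae ?_
    filter_upwards [(hy.intervalIntegrable_of_mem ht).ae_hasDerivAt_integral,
      (hz.intervalIntegrable_of_mem ht).ae_hasDerivAt_integral] with s h1 h2 hs
    have hs' := uIoc_subset_uIcc hs
    have hs'' : s ∈ Icc 0 T := by have := hsub hs'; rwa [uIcc_of_le hT] at this
    rw [((h1 hs' 0 (by simp)).const_add (y 0)).deriv, ((h2 hs' 0 (by simp)).const_add (z 0)).deriv,
      ← hy.2 s hs'', ← hz.2 s hs'']
  simp only [this]
  ring

theorem const_mul (c : ℝ) (hy : IsPrimitive T y f) :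
    IsPrimitive T (fun t => c * y t) (fun t => c * f t) := by
  refine ⟨hy.1.const_mul c, fun t ht => ?_⟩
  simp only [intervalIntegral.integral_const_mul]
  rw [hy.2 t ht]; ring

theorem add (hy : IsPrimitive T y f) (hz : IsPrimitive T z g) :
    IsPrimitive T (fun t => y t + z t) (fun t => f t + g t) := by
  refine ⟨hy.1.add hz.1, fun t ht => ?_⟩
  beta_reduce
  rw [intervalIntegral.integral_add (hy.intervalIntegrable_of_mem ht)
    (hz.intervalIntegrable_of_mem ht), hy.2 t ht, hz.2 t ht]; ring

theorem sub (hy : IsPrimitive T y f) (hz : IsPrimitive T z g) :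
    IsPrimitive T (fun t => y t - z t) (fun t => f t - g t) := by
  refine ⟨hy.1.sub hz.1, fun t ht => ?_⟩
  beta_reduce
  rw [intervalIntegral.integral_sub (hy.intervalIntegrable_of_mem ht)
    (hz.intervalIntegrable_of_mem ht), hy.2 t ht, hz.2 t ht]; ring

theorem sum {ι : Type*} (I : Finset ι) {y f : ι → ℝ → ℝ} (h : ∀ i ∈ I, IsPrimitive T (y i) (f i)) :
    IsPrimitive T (fun t => ∑ i ∈ I, y i t) (fun t => ∑ i ∈ I, f i t) := by
  classical
  induction I using Finset.induction_on with
  | empty => simp [IsPrimitive]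
  | insert i I hi ih =>
    simp only [Finset.sum_insert hi]
    exact (h i (by simp)).add (ih fun j hj => h j (by simp [hj]))

theorem of_hasDerivWithinAt (hT : 0 ≤ T)
    (h : ∀ t ∈ Icc 0 T, HasDerivWithinAt y (f t) (Icc 0 T) t)
    (hf : ContinuousOn f (Icc 0 T)) : IsPrimitive T y f := by
  have hint : IntervalIntegrable f volume 0 T :=
    ContinuousOn.intervalIntegrable (by rwa [uIcc_of_le hT])
  refine ⟨hint, fun t ht => ?_⟩
  have hsub : Icc 0 t ⊆ Icc 0 T := Icc_subset_Icc_right ht.2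
  rw [intervalIntegral.integral_eq_sub_of_hasDerivAt_of_le ht.1
    (fun s hs => ((h s (hsub hs)).continuousWithinAt.mono hsub))
    (fun s hs => (h s (hsub (Ioo_subset_Icc_self hs))).hasDerivAt
      (Icc_mem_nhds hs.1 (hs.2.trans_le ht.2)))
    (hint.mono_set (by rwa [uIcc_of_le ht.1, uIcc_of_le hT]))]
  ring

theorem of_test {φ : ℝ → ℝ} (hT : 0 ≤ T) (hφ : IsTest 0 T φ) : IsPrimitive T φ (deriv φ) :=
  of_hasDerivWithinAt hT
    (fun t _ => ((hφ.1.differentiable (by simp)) t).hasDerivAt.hasDerivWithinAt)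
    (hφ.1.continuous_deriv (by simp)).continuousOn

end IsPrimitive

/-! ### Test functions with zero mean and the lemma of du Bois-Reymond. -/

theorem IsTest.eq_zero {a b : ℝ} {φ : ℝ → ℝ} (hφ : IsTest a b φ) {x : ℝ} (hx : x ∉ Ioo a b) :
    φ x = 0 :=
  image_eq_zero_of_notMem_tsupport fun h => hx (hφ.2.2 h)

/-- Primitives of test functions with vanishing integral are test functions. -/
theorem IsTest.primitive {a b : ℝ} (hab : a < b) {ψ : ℝ → ℝ} (hψ : IsTest a b ψ)
    (h0 : ∫ t in a..b, ψ t = 0) :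
    IsTest a b (fun x => ∫ t in a..x, ψ t) ∧ deriv (fun x => ∫ t in a..x, ψ t) = ψ := by
  have hc : Continuous ψ := hψ.1.continuous
  have hd : ∀ x, HasDerivAt (fun x => ∫ t in a..x, ψ t) (ψ x) x := fun x =>
    intervalIntegral.integral_hasDerivAt_right (hc.intervalIntegrable _ _)
      (hc.stronglyMeasurableAtFilter _ _) hc.continuousAt
  have hderiv : deriv (fun x => ∫ t in a..x, ψ t) = ψ := funext fun x => (hd x).deriv
  have hsupp : ∃ c d, a < c ∧ d < b ∧ tsupport ψ ⊆ Icc c d := by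
    rcases (tsupport ψ).eq_empty_or_nonempty with he | hne
    · exact ⟨(a + b) / 2, (a + b) / 2, by linarith, by linarith, by simp [he]⟩
    · have hK : IsCompact (tsupport ψ) := hψ.2.1
      exact ⟨sInf (tsupport ψ), sSup (tsupport ψ), (hψ.2.2 (hK.sInf_mem hne)).1,
        (hψ.2.2 (hK.sSup_mem hne)).2,
        fun x hx => ⟨csInf_le hK.bddBelow hx, le_csSup hK.bddAbove hx⟩⟩
  obtain ⟨c, d, hac, hdb, hcd⟩ := hsupp
  have hz : ∀ x, x ∉ Icc c d → ψ x = 0 := fun x hx =>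
    image_eq_zero_of_notMem_tsupport fun h => hx (hcd h)
  -- Left of `c` nothing has been integrated yet; right of `d` the whole integral has been, and it
  -- is zero.
  have hout : ∀ x, x ∉ Icc c d → ∫ t in a..x, ψ t = 0 := by
    intro x hx
    rcases lt_or_ge x c with hxc | hxc
    · refine intervalIntegral.integral_zero_ae (Eventually.of_forall fun t ht => hz t ?_)
      intro h
      have := (uIoc_subset_uIcc ht)
      have h2 : t ≤ max a x := this.2
      exact absurd (h.1.trans h2) (not_le.2 (max_lt hac hxc))
    · have hxd : d < x := by
        by_contra! h
        exact hx ⟨hxc, h⟩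
      rw [← intervalIntegral.integral_add_adjacent_intervals (hc.intervalIntegrable a b)
        (hc.intervalIntegrable b x), h0, zero_add]
      refine intervalIntegral.integral_zero_ae (Eventually.of_forall fun t ht => hz t ?_)
      intro h
      have := (uIoc_subset_uIcc ht)
      have h2 : min b x ≤ t := this.1
      exact absurd (h2.trans h.2) (not_le.2 (lt_min hdb hxd))
  have hts : tsupport (fun x => ∫ t in a..x, ψ t) ⊆ Icc c d := by
    refine closure_minimal (fun x hx => ?_) isClosed_Icc
    by_contra h
    exact hx (hout x h)
  refine ⟨⟨?_, HasCompactSupport.of_support_subset_isCompact isCompact_Icc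
    ((subset_tsupport _).trans hts), hts.trans (Icc_subset_Ioo hac hdb)⟩, hderiv⟩
  rw [contDiff_infty_iff_deriv]
  exact ⟨fun x => (hd x).differentiableAt, by rw [hderiv]; exact hψ.1⟩

/-- Such an `η` corrects means: `ψ - (∫ ψ) η` has integral zero and is therefore the derivative of a
test function. -/
theorem exists_isTest_integral_eq_one {a b : ℝ} (hab : a < b) :
    ∃ η : ℝ → ℝ, IsTest a b η ∧ ∫ t in a..b, η t = 1 := by
  let f : ContDiffBump ((a + b) / 2) := ⟨(b - a) / 8, (b - a) / 4, by linarith, by linarith⟩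
  have hsub : tsupport (f.normed volume) ⊆ Ioo a b := by
    rw [f.tsupport_normed_eq, Real.closedBall_eq_Icc]
    exact Icc_subset_Ioo (by change a < (a + b) / 2 - (b - a) / 4; linarith)
      (by change (a + b) / 2 + (b - a) / 4 < b; linarith)
  refine ⟨f.normed volume, ⟨f.contDiff_normed, f.hasCompactSupport_normed, hsub⟩, ?_⟩
  rw [intervalIntegral.integral_eq_integral_of_support_subset
    ((subset_tsupport _).trans (hsub.trans Ioo_subset_Ioc_self)), f.integral_normed]

theorem IsTest.sub_smul {a b : ℝ} {ψ η : ℝ → ℝ} (hψ : IsTest a b ψ) (hη : IsTest a b η) (c : ℝ) :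
    IsTest a b (fun x => ψ x - c * η x) := by
  have hK := hψ.2.1.isCompact.union hη.2.1.isCompact
  have hs : Function.support (fun x => ψ x - c * η x) ⊆ tsupport ψ ∪ tsupport η := by
    intro x hx
    by_contra h
    rw [mem_union, not_or] at h
    exact hx (by simp [image_eq_zero_of_notMem_tsupport h.1, image_eq_zero_of_notMem_tsupport h.2])
  exact ⟨hψ.1.sub (contDiff_const.mul hη.1), HasCompactSupport.of_support_subset_isCompact hK hs,
    (closure_minimal hs hK.isClosed).trans (union_subset hψ.2.2 hη.2.2)⟩

/-- The lemma of du Bois-Reymond. -/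
theorem ae_eq_const_of_integral_deriv_mul_eq_zero {a b : ℝ} (hab : a < b) {F : ℝ → ℝ}
    (hF : IntegrableOn F (Ioo a b))
    (h : ∀ φ : ℝ → ℝ, IsTest a b φ → ∫ t in Ioo a b, deriv φ t * F t = 0) :
    ∃ c : ℝ, ∀ᵐ t, t ∈ Ioo a b → F t = c := by
  obtain ⟨η, hη, hη1⟩ := exists_isTest_integral_eq_one hab
  have hmul : ∀ ψ : ℝ → ℝ, IsTest a b ψ → IntegrableOn (fun t => ψ t * F t) (Ioo a b) := by
    intro ψ hψ
    obtain ⟨M, hM⟩ := hψ.2.1.exists_bound_of_continuous hψ.1.continuous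
    exact hF.bdd_mul hψ.1.continuous.aestronglyMeasurable (Eventually.of_forall hM)
  have hint : ∀ ψ : ℝ → ℝ, IsTest a b ψ → IntegrableOn ψ (Ioo a b) := fun ψ hψ =>
    (hψ.1.continuous.integrable_of_hasCompactSupport hψ.2.1).integrableOn
  -- The only possible value, since `η` has integral one.
  let c := ∫ t in Ioo a b, η t * F t
  refine ⟨c, ?_⟩
  have hFc : IntegrableOn (fun t => F t - c) (Ioo a b) := hF.sub (by simp)
  have key := isOpen_Ioo.ae_eq_zero_of_integral_contDiff_smul_eq_zero hFc.locallyIntegrableOn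
    (μ := volume) (fun ψ h1 h2 h3 => ?_)
  · filter_upwards [key] with t ht hm
    linarith [ht hm]
  · have hψ : IsTest a b ψ := ⟨h1, h2, h3⟩
    set k := ∫ t in a..b, ψ t with hk
    have hψ' := hψ.sub_smul hη k
    have h0 : ∫ t in a..b, (ψ t - k * η t) = 0 := by
      rw [intervalIntegral.integral_sub (h1.continuous.intervalIntegrable _ _)
        ((hη.1.continuous.intervalIntegrable _ _).const_mul k),
        intervalIntegral.integral_const_mul, hη1, ← hk]
      ring
    obtain ⟨h4, h5⟩ := hψ'.primitive hab h0
    have h6 := h _ h4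
    rw [h5] at h6
    have h7 : ∫ t in Ioo a b, ψ t * F t = k * c := by
      have : ∀ t, (ψ t - k * η t) * F t = ψ t * F t - k * (η t * F t) := fun t => by ring
      simp only [this] at h6
      rw [integral_sub (hmul ψ hψ) ((hmul η hη).const_mul k), integral_const_mul] at h6
      linarith
    rw [← setIntegral_eq_integral_of_forall_compl_eq_zero (s := Ioo a b)
      (fun x hx => by simp [hψ.eq_zero hx])]
    simp only [smul_eq_mul, mul_sub]
    rw [integral_sub (hmul ψ hψ) ((hint ψ hψ).mul_const c), h7, integral_mul_const, hk,
      intervalIntegral.integral_of_le hab.le, integral_Ioc_eq_integral_Ioo]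
    ring

/-- A continuous function with an integrable weak derivative is a primitive of it. -/
theorem IsPrimitive.of_weak {T : ℝ} (hT : 0 < T) {y f : ℝ → ℝ} (hy : ContinuousOn y (Icc 0 T))
    (hf : IntegrableOn f (Ioo 0 T))
    (h : ∀ φ : ℝ → ℝ, IsTest 0 T φ →
      ∫ t in Ioo 0 T, deriv φ t * y t = -∫ t in Ioo 0 T, φ t * f t) :
    IsPrimitive T y f := by
  have hfi : IntervalIntegrable f volume 0 T :=
    (intervalIntegrable_iff_integrableOn_Ioo_of_le hT.le).2 hf
  have hP : IsPrimitive T (fun t => ∫ s in (0 : ℝ)..t, f s) f := ⟨hfi, by simp⟩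
  have hPc := hP.continuousOn hT.le
  have hdc : ContinuousOn (fun t => y t - ∫ s in (0 : ℝ)..t, f s) (Icc 0 T) := hy.sub hPc
  have hint : ∀ u : ℝ → ℝ, ContinuousOn u (Icc 0 T) → IntegrableOn u (Ioo 0 T) := fun u hu =>
    (hu.integrableOn_Icc).mono_set Ioo_subset_Icc_self
  -- Integration by parts shows that `y` minus the primitive of `f` has weak derivative zero.
  -- Continuity later turns a.e. constancy into constancy on `[0,T]`.
  obtain ⟨c, hc⟩ := ae_eq_const_of_integral_deriv_mul_eq_zero hT (hint _ hdc) (by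
    intro φ hφ
    have hφc : Continuous (deriv φ) := hφ.1.continuous_deriv (by simp)
    have h1 := ((IsPrimitive.of_test hT.le hφ).mul hT.le hP).2 T (by simp [hT.le])
    beta_reduce at h1
    rw [hφ.eq_zero (x := T) (by simp), hφ.eq_zero (x := 0) (by simp), zero_mul,
      zero_mul, zero_add] at h1
    have hi1 : IntegrableOn (fun t => deriv φ t * ∫ s in (0 : ℝ)..t, f s) (Ioo 0 T) :=
      hint _ (hφc.continuousOn.mul hPc)
    have hi2 : IntegrableOn (fun t => φ t * f t) (Ioo 0 T) := by
      obtain ⟨M, hM⟩ := hφ.2.1.exists_bound_of_continuous hφ.1.continuous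
      exact hf.bdd_mul hφ.1.continuous.aestronglyMeasurable (Eventually.of_forall hM)
    rw [intervalIntegral.integral_of_le hT.le, integral_Ioc_eq_integral_Ioo,
      integral_add hi1 hi2] at h1
    have hi3 : IntegrableOn (fun t => deriv φ t * y t) (Ioo 0 T) :=
      hint _ (hφc.continuousOn.mul hy)
    simp only [mul_sub]
    rw [integral_sub hi3 hi1, h φ hφ]
    linarith)
  have hae : (fun t => y t - ∫ s in (0 : ℝ)..t, f s) =ᵐ[volume.restrict (Ioo 0 T)] fun _ => c :=
    (ae_restrict_iff' measurableSet_Ioo).2 hc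
  have heq : EqOn (fun t => y t - ∫ s in (0 : ℝ)..t, f s) (fun _ => c) (Ioo 0 T) :=
    Measure.eqOn_open_of_ae_eq hae isOpen_Ioo (hdc.mono Ioo_subset_Icc_self) continuousOn_const
  have heq' : EqOn (fun t => y t - ∫ s in (0 : ℝ)..t, f s) (fun _ => c) (Icc 0 T) :=
    heq.of_subset_closure hdc continuousOn_const Ioo_subset_Icc_self
      (by rw [closure_Ioo hT.ne])
  refine ⟨hfi, fun t ht => ?_⟩
  have h1 := heq' ht
  have h2 := heq' (left_mem_Icc.2 hT.le)
  simp only [intervalIntegral.integral_same, sub_zero] at h1 h2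
  rw [h2]; linarith

/-! ### Functions of `H₀¹(a,b)` -/

section H01

variable {a b : ℝ}

theorem energy_eq_inner (u v : H01 a b) : energy u v = inner ℝ (weakDeriv u) (weakDeriv v) := by
  rw [L2.inner_def]
  simp [energy, mul_comm]

theorem energyNorm_eq_norm (u : H01 a b) : energyNorm u = ‖weakDeriv u‖ := by
  rw [energyNorm, energy_eq_inner, real_inner_self_eq_norm_sq, Real.sqrt_sq (norm_nonneg _)]

theorem energy_self (u : H01 a b) : energy u u = energyNorm u ^ 2 := by
  rw [energyNorm_eq_norm, energy_eq_inner, real_inner_self_eq_norm_sq]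

/-- Cauchy-Schwarz against the indicator of the interval; this is the source of the Hölder exponent
1/2. -/
theorem norm_intervalIntegral_le (p : L2 a b) {x y : ℝ} (hxy : x ≤ y) :
    |∫ t in x..y, p t ∂(volume.restrict (Ioo a b))| ≤ Real.sqrt (y - x) * ‖p‖ := by
  rw [← Real.norm_eq_abs, intervalIntegral.norm_integral_eq_norm_integral_uIoc]
  have hs : MeasurableSet (uIoc x y) := measurableSet_uIoc
  have hne : (volume.restrict (Ioo a b)) (uIoc x y) ≠ ⊤ := measure_ne_top _ _
  rw [← L2.inner_indicatorConstLp_one (𝕜 := ℝ) hs hne p]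
  refine (norm_inner_le_norm _ _).trans ?_
  gcongr
  rw [norm_indicatorConstLp (by norm_num) (by norm_num), norm_one, one_mul, Real.sqrt_eq_rpow]
  norm_num
  refine Real.rpow_le_rpow measureReal_nonneg ?_ (by norm_num)
  rw [uIoc_of_le hxy]
  have := measureReal_mono (μ := volume) (s₁ := Ioc x y ∩ Ioo a b) inter_subset_left
    (by simp)
  simpa [Real.volume_real_Ioc_of_le hxy] using this

theorem contRep_sub (u : H01 a b) (x y : ℝ) :
    contRep a b u y - contRep a b u x
      = ∫ t in x..y, weakDeriv u t ∂(volume.restrict (Ioo a b)) := by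
  rw [contRep_apply, contRep_apply, intervalIntegral.integral_interval_sub_left]
  · exact intervalIntegrable_L2 _ _ _
  · exact intervalIntegrable_L2 _ _ _

theorem abs_contRep_sub_le (u : H01 a b) {x y : ℝ} (hxy : x ≤ y) :
    |contRep a b u y - contRep a b u x| ≤ Real.sqrt (y - x) * energyNorm u := by
  rw [contRep_sub, energyNorm_eq_norm]
  exact norm_intervalIntegral_le _ hxy

theorem contRep_of_le (u : H01 a b) {x : ℝ} (hx : x ≤ a) : contRep a b u x = 0 := by
  rw [contRep_apply, intervalIntegral.integral_of_ge hx,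
    Measure.restrict_restrict measurableSet_Ioc, show Ioc x a ∩ Ioo a b = ∅ by ext t; simp; intro _ h h2; linarith]
  simp

/-- The value at `b` is a bounded functional of the weak derivative that vanishes on test functions,
hence on their closure. -/
theorem contRep_right (hab : a < b) (u : H01 a b) : contRep a b u b = 0 := by
  let E : PairSpace a b →L[ℝ] ℝ := (BoundedContinuousFunction.evalCLM ℝ b).comp
    ((primitive a b).comp (WithLp.sndL 2 ℝ (L2 a b) (L2 a b)))
  have hle : H01Submodule a b ≤ E.ker := by
    refine Submodule.topologicalClosure_minimal _ (Submodule.span_le.2 ?_) E.isClosed_ker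
    rintro w ⟨φ, hφ, -, h2⟩
    change ∫ t in a..b, w.snd t ∂(volume.restrict (Ioo a b)) = 0
    rw [intervalIntegral.integral_congr_ae_restrict (ae_restrict_of_ae h2),
      intervalIntegral.integral_of_le hab.le, Measure.restrict_restrict measurableSet_Ioc,
      inter_eq_right.2 Ioo_subset_Ioc_self, ← integral_Ioc_eq_integral_Ioo,
      ← intervalIntegral.integral_of_le hab.le, intervalIntegral.integral_deriv_eq_sub
      (fun y _ => (hφ.1.differentiable (by simp)).differentiableAt)
      ((hφ.1.continuous_deriv (by simp)).intervalIntegrable _ _), hφ.eq_zero (x := a) (by simp),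
      hφ.eq_zero (x := b) (by simp), sub_zero]
  exact hle u.2

theorem contRep_of_ge (hab : a < b) (u : H01 a b) {x : ℝ} (hx : b ≤ x) : contRep a b u x = 0 := by
  have h := contRep_sub u b x
  rw [contRep_right hab, sub_zero, intervalIntegral.integral_of_le hx,
    Measure.restrict_restrict measurableSet_Ioc,
    show Ioc b x ∩ Ioo a b = ∅ by ext t; simp; intro h _ _; linarith] at h
  simpa using h

theorem abs_contRep_le (hab : a < b) (u : H01 a b) (x : ℝ) :
    |contRep a b u x| ≤ Real.sqrt (b - a) * energyNorm u := by
  have h := abs_primitive_le (weakDeriv u) x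
  rw [energyNorm_eq_norm, contRep_apply]
  simpa [Real.volume_real_Ioo_of_le hab.le] using h

/-- Poincaré inequality. It makes a curve that is square integrable in the energy norm Bochner
integrable in the norm of `H01`. -/
theorem norm_le_energyNorm (hab : a < b) (u : H01 a b) :
    ‖u‖ ≤ Real.sqrt ((b - a) ^ 2 + 1) * energyNorm u := by
  have h1 : ‖(u : PairSpace a b).fst‖ ≤ (b - a) * energyNorm u := by
    have hb := Lp.norm_le_of_ae_bound (f := (u : PairSpace a b).fst)
      (C := Real.sqrt (b - a) * energyNorm u) (by unfold energyNorm; positivity) (by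
        filter_upwards [contRep_ae_eq u] with x hx
        rw [← hx]
        exact abs_contRep_le hab u x)
    refine hb.trans (le_of_eq ?_)
    simp only [measureUnivNNReal]
    have : (((volume.restrict (Ioo a b)) univ).toNNReal : ℝ) = b - a := by
      rw [Measure.restrict_apply_univ, Real.volume_Ioo]
      exact ENNReal.toReal_ofReal (by linarith)
    rw [this]
    norm_num
    rw [← Real.sqrt_eq_rpow, ← mul_assoc, Real.mul_self_sqrt (by linarith)]
  have h2 : ‖u‖ ^ 2 = ‖(u : PairSpace a b).fst‖ ^ 2 + energyNorm u ^ 2 := by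
    rw [energyNorm_eq_norm]
    exact WithLp.prod_norm_sq_eq_of_L2 (u : PairSpace a b)
  have h0 : 0 ≤ energyNorm u := Real.sqrt_nonneg _
  refine abs_le_of_sq_le_sq' ?_ (by positivity) |>.2
  rw [h2, mul_pow, Real.sq_sqrt (by positivity)]
  have := pow_le_pow_left₀ (norm_nonneg _) h1 2
  nlinarith

/-- Lebesgue differentiation. It identifies the stiffness matrix, written with `deriv`, with the
energy form. -/
theorem weakDeriv_ae_eq_deriv (u : H01 a b) :
    (weakDeriv u : ℝ → ℝ) =ᵐ[volume.restrict (Ioo a b)] deriv (contRep a b u) := by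
  refine (ae_restrict_iff' measurableSet_Ioo).2 ?_
  have hint : Integrable ((Ioo a b).indicator (weakDeriv u)) volume :=
    (integrable_indicator_iff measurableSet_Ioo).2 ((Lp.memLp _).integrable (by norm_num))
  filter_upwards [LocallyIntegrable.ae_hasDerivAt_integral hint.locallyIntegrable] with x hx hxab
  have h1 := hx a
  rw [indicator_of_mem hxab] at h1
  refine ((h1.congr_of_eventuallyEq ?_).deriv).symm
  filter_upwards [isOpen_Ioo.mem_nhds hxab] with y hy
  rw [contRep_apply, intervalIntegral.integral_of_le hy.1.le,
    intervalIntegral.integral_of_le hy.1.le, integral_indicator measurableSet_Ioo,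
    Measure.restrict_restrict measurableSet_Ioo, Measure.restrict_restrict measurableSet_Ioc,
    inter_comm]

theorem eq_zero_of_contRep_eq_zero {u : H01 a b} (h : ∀ x ∈ Ioo a b, contRep a b u x = 0) :
    u = 0 := by
  have hsnd : (u : PairSpace a b).snd = 0 := by
    refine Lp.ext ?_
    filter_upwards [weakDeriv_ae_eq_deriv u, Lp.coeFn_zero ℝ 2 (volume.restrict (Ioo a b)),
      ae_restrict_mem measurableSet_Ioo] with x h1 h2 h3
    refine h1.trans ?_
    rw [h2]
    exact ((hasDerivAt_const x (0 : ℝ)).congr_of_eventuallyEq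
      (Filter.mem_of_superset (isOpen_Ioo.mem_nhds h3) h)).deriv
  have hfst : (u : PairSpace a b).fst = 0 := by
    refine Lp.ext ?_
    filter_upwards [contRep_ae_eq u, Lp.coeFn_zero ℝ 2 (volume.restrict (Ioo a b)),
      ae_restrict_mem measurableSet_Ioo] with x h1 h2 h3
    rw [← h1, h2, h x h3]; rfl
  refine Subtype.ext ?_
  apply (WithLp.equiv 2 _).injective
  exact Prod.ext hfst hsnd

theorem IsTest.memLp {φ : ℝ → ℝ} (hφ : IsTest a b φ) : MemLp φ 2 (volume.restrict (Ioo a b)) :=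
  (hφ.1.continuous.memLp_of_hasCompactSupport hφ.2.1).restrict _

/-- Test functions are dense in `L²(a,b)`. -/
theorem topologicalClosure_span_isTest :
    (Submodule.span ℝ {w : L2 a b | ∃ φ : ℝ → ℝ, IsTest a b φ ∧
      (w : ℝ → ℝ) =ᵐ[volume.restrict (Ioo a b)] φ}).topologicalClosure = ⊤ := by
  rw [Submodule.topologicalClosure_eq_top_iff, Submodule.eq_bot_iff]
  intro f hf
  have hloc : LocallyIntegrableOn f (Ioo a b) volume :=
    IntegrableOn.locallyIntegrableOn ((Lp.memLp f).integrable (by norm_num))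
  have key := isOpen_Ioo.ae_eq_zero_of_integral_contDiff_smul_eq_zero hloc
    (fun ψ h1 h2 h3 => ?_)
  · refine Lp.ext ((Filter.EventuallyEq.trans ?_ (Lp.coeFn_zero _ _ _).symm))
    exact (ae_restrict_iff' measurableSet_Ioo).2 key
  · have hψ : IsTest a b ψ := ⟨h1, h2, h3⟩
    have h4 := (Submodule.mem_orthogonal _ _).1 hf _
      (Submodule.subset_span ⟨ψ, hψ, hψ.memLp.coeFn_toLp⟩)
    rw [L2.inner_def] at h4
    rw [← setIntegral_eq_integral_of_forall_compl_eq_zero (s := Ioo a b)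
      (fun x hx => by simp [hψ.eq_zero hx]), ← h4]
    refine integral_congr_ae ?_
    filter_upwards [hψ.memLp.coeFn_toLp] with x hx
    simp [hx, mul_comm]

/-- Every function of `L²(a,b)` with mean zero is the weak derivative of a function of
`H₀¹(a,b)`. -/
theorem exists_weakDeriv_eq (hab : a < b) (p : L2 a b) (hp : ∫ x in Ioo a b, p x = 0) :
    ∃ u : H01 a b, weakDeriv u = p := by
  obtain ⟨η, hη, hη1⟩ := exists_isTest_integral_eq_one hab
  let ηL : L2 a b := hη.memLp.toLp η
  let ev : L2 a b →L[ℝ] ℝ := (BoundedContinuousFunction.evalCLM ℝ b).comp (primitive a b)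
  have hev : ∀ q : L2 a b, ev q = ∫ x in Ioo a b, q x := by
    intro q
    change ∫ t in a..b, q t ∂(volume.restrict (Ioo a b)) = _
    rw [intervalIntegral.integral_of_le hab.le, Measure.restrict_restrict measurableSet_Ioc,
      inter_eq_right.2 Ioo_subset_Ioc_self]
  let P : L2 a b →L[ℝ] L2 a b :=
    (BoundedContinuousFunction.toLp 2 (volume.restrict (Ioo a b)) ℝ).comp (primitive a b)
  -- `J` pairs a function with its primitive and `Q` removes the mean along `η`. On test functions
  -- `J ∘ Q` lands on the generators of `H01Submodule`, so by density and closedness it maps all of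
  -- `L2` there, and `Q` fixes `p`.
  let J : L2 a b →L[ℝ] PairSpace a b :=
    (WithLp.prodContinuousLinearEquiv 2 ℝ (L2 a b) (L2 a b)).symm.toContinuousLinearMap.comp
      (P.prod (ContinuousLinearMap.id ℝ _))
  let Q : L2 a b →L[ℝ] L2 a b := ContinuousLinearMap.id ℝ _ - ev.smulRight ηL
  have hJ : ∀ q, (J q).snd = q := fun q => rfl
  have hQ : ∀ q, Q q = q - ev q • ηL := fun q => rfl
  have hclosed : IsClosed
      (((H01Submodule a b).comap (J.comp Q).toLinearMap : Submodule ℝ (L2 a b)) : Set (L2 a b)) :=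
    (Submodule.isClosed_topologicalClosure _).preimage (J.comp Q).continuous
  have htop : (⊤ : Submodule ℝ (L2 a b)) ≤ (H01Submodule a b).comap (J.comp Q).toLinearMap := by
    rw [← topologicalClosure_span_isTest]
    refine Submodule.topologicalClosure_minimal _ (Submodule.span_le.2 ?_) hclosed
    rintro w ⟨ψ, hψ, hw⟩
    set k := ev w with hk
    have hk' : k = ∫ t in a..b, ψ t := by
      rw [hk, hev, integral_congr_ae hw, intervalIntegral.integral_of_le hab.le,
        integral_Ioc_eq_integral_Ioo]
    have hψ' := hψ.sub_smul hη k
    have h0 : ∫ t in a..b, (ψ t - k * η t) = 0 := by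
      rw [intervalIntegral.integral_sub (hψ.1.continuous.intervalIntegrable _ _)
        ((hη.1.continuous.intervalIntegrable _ _).const_mul k),
        intervalIntegral.integral_const_mul, hη1, ← hk']
      ring
    obtain ⟨h4, h5⟩ := hψ'.primitive hab h0
    have hQw : (Q w : ℝ → ℝ) =ᵐ[volume.restrict (Ioo a b)] fun x => ψ x - k * η x := by
      rw [hQ]
      filter_upwards [Lp.coeFn_sub w (ev w • ηL), Lp.coeFn_smul (ev w) ηL, hw,
        hη.memLp.coeFn_toLp] with x h1 h2 h3 h4
      rw [h1, Pi.sub_apply, h2, Pi.smul_apply, h3, h4]; rfl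
    refine (Submodule.le_topologicalClosure _) (Submodule.subset_span ⟨_, h4, ?_, ?_⟩)
    · refine (BoundedContinuousFunction.coeFn_toLp (p := 2) (𝕜 := ℝ) _ _).trans ?_
      refine (ae_restrict_iff' measurableSet_Ioo).2 (Eventually.of_forall fun x hx => ?_)
      change ∫ t in a..x, Q w t ∂(volume.restrict (Ioo a b)) = _
      rw [intervalIntegral.integral_congr_ae_restrict (ae_restrict_of_ae hQw),
        intervalIntegral.integral_of_le hx.1.le, Measure.restrict_restrict measurableSet_Ioc,
        inter_eq_left.2 (show Ioc a x ⊆ Ioo a b from fun y hy => ⟨hy.1, hy.2.trans_lt hx.2⟩),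
        ← intervalIntegral.integral_of_le hx.1.le]
    · rw [h5]; exact hQw
  have hQp : Q p = p := by rw [hQ, hev, hp, zero_smul, sub_zero]
  have hmem : J (Q p) ∈ H01Submodule a b := htop (Submodule.mem_top (x := p))
  exact ⟨⟨J (Q p), hmem⟩, by rw [weakDeriv, hJ, hQp]⟩

end H01

/-! ### Ordered nodes -/

section Node

variable {V : Finset ℝ}

theorem node_eq_getElem {i : ℕ} (hi : i < V.card) :
    node V i = (V.sort (· ≤ ·))[i]'(by simpa using hi) :=
  List.getD_eq_getElem _ _ _

theorem node_mem {i : ℕ} (hi : i < V.card) : node V i ∈ V := by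
  rw [node_eq_getElem hi]
  exact (Finset.mem_sort _).1 (List.getElem_mem _)

theorem node_lt_node {i j : ℕ} (hij : i < j) (hj : j < V.card) : node V i < node V j := by
  rw [node_eq_getElem hj, node_eq_getElem (hij.trans hj)]
  exact V.sortedLT_sort.getElem_lt_getElem_of_lt hij

theorem node_le_node {i j : ℕ} (hij : i ≤ j) (hj : j < V.card) : node V i ≤ node V j := by
  rcases hij.eq_or_lt with rfl | h
  · exact le_rfl
  · exact (node_lt_node h hj).le

theorem exists_node_eq {x : ℝ} (hx : x ∈ V) : ∃ i < V.card, node V i = x := by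
  obtain ⟨i, hi, h⟩ := List.getElem_of_mem ((Finset.mem_sort (· ≤ ·)).2 hx)
  have hi' : i < V.card := by simpa using hi
  exact ⟨i, hi', by rw [node_eq_getElem hi', h]⟩

/-- `V` is a finite subset of `[a,b]` that contains the end-points and whose gaps are at most
`δ`. -/
structure IsMesh (V : Finset ℝ) (a b δ : ℝ) : Prop where
  subset : ∀ x ∈ V, x ∈ Icc a b
  left_mem : a ∈ V
  right_mem : b ∈ V
  one_lt_card : 1 < V.card
  gap : ∀ i, i + 1 < V.card → node V (i + 1) - node V i ≤ δ

variable {a b δ : ℝ}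

theorem IsMesh.node_zero (hV : IsMesh V a b δ) : node V 0 = a := by
  obtain ⟨i, hi, h⟩ := exists_node_eq hV.left_mem
  have h0 : 0 < V.card := by have := hV.one_lt_card; omega
  refine le_antisymm ?_ (hV.subset _ (node_mem h0)).1
  rw [← h]
  exact node_le_node (Nat.zero_le _) hi

theorem IsMesh.node_last (hV : IsMesh V a b δ) : node V (V.card - 1) = b := by
  obtain ⟨i, hi, h⟩ := exists_node_eq hV.right_mem
  have h0 : V.card - 1 < V.card := by have := hV.one_lt_card; omega
  refine le_antisymm (hV.subset _ (node_mem h0)).2 ?_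
  rw [← h]
  exact node_le_node (by omega) h0

theorem IsMesh.exists_mem_Icc (hV : IsMesh V a b δ) {x : ℝ} (hx : x ∈ Icc a b) :
    ∃ i, i + 1 < V.card ∧ x ∈ Icc (node V i) (node V (i + 1)) := by
  classical
  have h1 := hV.one_lt_card
  -- Requiring a positive index ensures a left neighbour, also when `x = a`.
  have hex : ∃ i, 0 < i ∧ x ≤ node V i :=
    ⟨V.card - 1, by omega, by rw [hV.node_last]; exact hx.2⟩
  obtain ⟨hpos, hle⟩ := Nat.find_spec hex
  set k := Nat.find hex with hk
  have hkc : k ≤ V.card - 1 := Nat.find_min' hex ⟨by omega, by rw [hV.node_last]; exact hx.2⟩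
  obtain ⟨i, hi⟩ : ∃ i, k = i + 1 := ⟨k - 1, by omega⟩
  refine ⟨i, by omega, ?_, by rwa [← hi]⟩
  rcases Nat.eq_zero_or_pos i with rfl | hi0
  · rw [hV.node_zero]; exact hx.1
  · have := Nat.find_min hex (m := i) (by omega)
    push Not at this
    exact (this hi0).le

end Node

/-! ### The intervals of the auxiliary iterated function system -/

section IFS

variable {N : ℕ} {r : ℝ} {n : Fin N → ℕ} {d : Fin N → ℝ} {a b : ℝ}

open scoped Pointwise in
theorem volume_image_auxMap (hr : 0 < r) (j : Fin N) (U : Set ℝ) :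
    volume (auxMap r n d j '' U) = ENNReal.ofReal (r ^ n j) * volume U := by
  have : auxMap r n d j '' U = (fun x => x + d j) '' ((r ^ n j) • U) := by
    rw [← image_smul, image_image]; rfl
  rw [this, image_add_right, measure_preimage_add_right, Measure.addHaar_smul]
  simp [abs_of_pos hr]

open scoped Pointwise in
theorem isOpen_image_auxMap (hr : 0 < r) (j : Fin N) {U : Set ℝ} (hU : IsOpen U) :
    IsOpen (auxMap r n d j '' U) := by
  have : auxMap r n d j '' U = (fun x => x + d j) '' ((r ^ n j) • U) := by
    rw [← image_smul, image_image]; rfl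
  rw [this]
  exact (Homeomorph.addRight (d j)).isOpenMap _ (hU.smul₀ (pow_pos hr _).ne')

/-- Compare Lebesgue measures: the images of `U` are disjoint and lie in `U`, whose volume is
positive and finite and so cancels. -/
theorem OpenSetCondition.sum_le_one (hr : 0 < r) (h : OpenSetCondition (auxMap r n d)) :
    ∑ j, ENNReal.ofReal (r ^ n j) ≤ 1 := by
  obtain ⟨U, hne, hbd, hU, hsub, hdisj⟩ := h
  have h1 : volume (⋃ j, auxMap r n d j '' U) = ∑ j, volume (auxMap r n d j '' U) := by
    rw [measure_iUnion (fun i j hij => hdisj i j hij)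
      (fun j => (isOpen_image_auxMap hr j hU).measurableSet), tsum_fintype]
  have h2 := measure_mono (μ := volume) hsub
  simp only [h1, volume_image_auxMap hr, ← Finset.sum_mul] at h2
  refine (ENNReal.mul_le_mul_iff_left (hU.measure_pos volume hne).ne' hbd.measure_lt_top.ne).1 ?_
  rwa [one_mul]

/-- The images of `[a,b]` cover `[a,b]` and have total length at most `b - a`, so what sticks out is
null. The part of the image of `(a,b)` outside `[a,b]` is open and null, hence empty; the end-points
follow by closure. -/
theorem auxMap_mem_Icc (hab : a < b) (hr : 0 < r) (h : OpenSetCondition (auxMap r n d))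
    (hcov : Icc a b ⊆ ⋃ j, auxMap r n d j '' Icc a b) (j : Fin N) {x : ℝ} (hx : x ∈ Icc a b) :
    auxMap r n d j x ∈ Icc a b := by
  have hvol : volume (⋃ j, auxMap r n d j '' Icc a b) ≤ volume (Icc a b) := by
    refine (measure_iUnion_le _).trans ?_
    simp only [tsum_fintype, volume_image_auxMap hr, ← Finset.sum_mul]
    exact mul_le_of_le_one_left' (h.sum_le_one hr)
  have hdiff : volume ((⋃ j, auxMap r n d j '' Icc a b) \ Icc a b) = 0 := by
    rw [measure_sdiff hcov measurableSet_Icc.nullMeasurableSet (by simp)]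
    exact tsub_eq_zero_of_le hvol
  have hemp : (auxMap r n d j '' Ioo a b) \ Icc a b = ∅ := by
    refine (((isOpen_image_auxMap hr j isOpen_Ioo).sdiff isClosed_Icc).measure_eq_zero_iff
      volume).1 (measure_mono_null (sdiff_subset_sdiff_left ?_) hdiff)
    exact (image_mono Ioo_subset_Icc_self).trans
      (subset_iUnion (fun j => auxMap r n d j '' Icc a b) j)
  have hsub : MapsTo (auxMap r n d j) (Ioo a b) (Icc a b) := by
    intro y hy
    exact sdiff_eq_empty.1 hemp ⟨y, hy, rfl⟩
  have hcont : Continuous (auxMap r n d j) := by unfold auxMap; fun_prop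
  have := hsub.closure hcont
  rw [closure_Ioo hab.ne, closure_Icc] at this
  exact this hx

theorem wordMap_succ {T : Fin N → ℝ → ℝ} {m : ℕ} (J : Fin (m + 1) → Fin N) (x : ℝ) :
    wordMap T J x = T (J 0) (wordMap T (fun i => J i.succ) x) := by
  simp [wordMap, List.ofFn_succ]

theorem wordMap_affine (hr : 0 < r) {ρ : ℝ} (hρ : ∀ j, r ^ n j ≤ ρ) {m : ℕ} (J : Fin m → Fin N) :
    ∃ R D : ℝ, 0 < R ∧ R ≤ ρ ^ m ∧ ∀ x, wordMap (auxMap r n d) J x = R * x + D := by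
  induction m with
  | zero => exact ⟨1, 0, one_pos, by simp, fun x => by simp [wordMap]⟩
  | succ m ih =>
    obtain ⟨R, D, h1, h2, h3⟩ := ih fun i => J i.succ
    have h4 := pow_pos hr (n (J 0))
    refine ⟨r ^ n (J 0) * R, r ^ n (J 0) * D + d (J 0), mul_pos h4 h1, ?_, fun x => ?_⟩
    · rw [pow_succ']
      exact mul_le_mul (hρ _) h2 h1.le (h4.le.trans (hρ _))
    · rw [wordMap_succ, h3, auxMap]; ring

theorem wordMap_mem_Icc {T : Fin N → ℝ → ℝ} (hT : ∀ j, ∀ x ∈ Icc a b, T j x ∈ Icc a b) {m : ℕ}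
    (J : Fin m → Fin N) {x : ℝ} (hx : x ∈ Icc a b) : wordMap T J x ∈ Icc a b := by
  induction m with
  | zero => simpa [wordMap] using hx
  | succ m ih => rw [wordMap_succ]; exact hT _ _ (ih _)

theorem exists_wordMap_eq {T : Fin N → ℝ → ℝ} {S : Set ℝ} (hcov : S ⊆ ⋃ j, T j '' S) (m : ℕ)
    {x : ℝ} (hx : x ∈ S) : ∃ J : Fin m → Fin N, ∃ y ∈ S, wordMap T J y = x := by
  induction m generalizing x with
  | zero => exact ⟨Fin.elim0, x, hx, by simp [wordMap]⟩
  | succ m ih =>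
    obtain ⟨j, y, hy, rfl⟩ := mem_iUnion.1 (hcov hx)
    obtain ⟨J, z, hz, rfl⟩ := ih hy
    exact ⟨Fin.cons j J, z, hz, by simp [wordMap_succ]⟩

/-- The nodes of level `m` form a mesh of width at most `ρ^m (b - a)`. -/
theorem isMesh_nodeSet (hab : a < b) (hr : 0 < r) (h : OpenSetCondition (auxMap r n d))
    (hcov : Icc a b ⊆ ⋃ j, auxMap r n d j '' Icc a b) {ρ : ℝ} (hρ : ∀ j, r ^ n j ≤ ρ) (m : ℕ) :
    IsMesh (nodeSet (auxMap r n d) a b m) a b (ρ ^ m * (b - a)) := by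
  set V := nodeSet (auxMap r n d) a b m with hV
  have hmemV : ∀ x, x ∈ V ↔ (∃ J : Fin m → Fin N, wordMap (auxMap r n d) J a = x) ∨
      ∃ J : Fin m → Fin N, wordMap (auxMap r n d) J b = x := by
    intro x; simp [hV, nodeSet]
  have hmaps : ∀ j, ∀ x ∈ Icc a b, auxMap r n d j x ∈ Icc a b := fun j x hx =>
    auxMap_mem_Icc hab hr h hcov j hx
  have ha : a ∈ Icc a b := left_mem_Icc.2 hab.le
  have hb : b ∈ Icc a b := right_mem_Icc.2 hab.le
  have hmono : ∀ (J : Fin m → Fin N) {x y : ℝ}, x ≤ y →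
      wordMap (auxMap r n d) J x ≤ wordMap (auxMap r n d) J y := by
    intro J x y hxy
    obtain ⟨R, D, h1, -, h3⟩ := wordMap_affine (d := d) hr hρ J
    rw [h3, h3]; nlinarith
  have haV : a ∈ V := by
    obtain ⟨J, y, hy, hJ⟩ := exists_wordMap_eq hcov m ha
    refine (hmemV a).2 (Or.inl ⟨J, le_antisymm ?_ (wordMap_mem_Icc hmaps J ha).1⟩)
    rw [← hJ]
    nth_rewrite 1 [hJ]
    exact hmono J hy.1
  have hbV : b ∈ V := by
    obtain ⟨J, y, hy, hJ⟩ := exists_wordMap_eq hcov m hb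
    refine (hmemV b).2 (Or.inr ⟨J, le_antisymm (wordMap_mem_Icc hmaps J hb).2 ?_⟩)
    rw [← hJ]
    nth_rewrite 2 [hJ]
    exact hmono J hy.2
  have hsubV : ∀ x ∈ V, x ∈ Icc a b := by
    intro x hx
    rcases (hmemV x).1 hx with ⟨J, rfl⟩ | ⟨J, rfl⟩
    · exact wordMap_mem_Icc hmaps J ha
    · exact wordMap_mem_Icc hmaps J hb
  refine ⟨hsubV, haV, hbV, Finset.one_lt_card.2 ⟨a, haV, b, hbV, hab.ne⟩, fun i hi => ?_⟩
  · have hlt := node_lt_node (Nat.lt_succ_self i) hi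
    have hi' : i < V.card := by omega
    set x := node V i
    set y := node V (i + 1)
    have hxI : x ∈ Icc a b := hsubV x (node_mem hi')
    have hyI : y ∈ Icc a b := hsubV y (node_mem hi)
    -- Some level-`m` interval contains the midpoint of the gap. Its end-points are nodes and no
    -- node lies strictly between `x` and `y`, so it contains `[x,y]`.
    obtain ⟨J, w, hw, hz⟩ := exists_wordMap_eq hcov m (x := (x + y) / 2)
      ⟨by linarith [hxI.1, hyI.1], by linarith [hxI.2, hyI.2]⟩
    have hpz := hmono J hw.1
    have hzq := hmono J hw.2
    rw [hz] at hpz hzq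
    have hp : wordMap (auxMap r n d) J a ≤ x := by
      obtain ⟨k, hk, hkeq⟩ := exists_node_eq ((hmemV _).2 (Or.inl ⟨J, rfl⟩))
      rw [← hkeq] at hpz ⊢
      refine node_le_node ?_ hi'
      by_contra! hcon
      have : y ≤ node V k := node_le_node hcon hk
      linarith
    have hq : y ≤ wordMap (auxMap r n d) J b := by
      obtain ⟨k, hk, hkeq⟩ := exists_node_eq ((hmemV _).2 (Or.inr ⟨J, rfl⟩))
      rw [← hkeq] at hzq ⊢
      refine node_le_node ?_ hk
      by_contra! hcon
      have : node V k ≤ x := node_le_node (by omega) hi'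
      linarith
    obtain ⟨R, D, h1, h2, h3⟩ := wordMap_affine (d := d) hr hρ J
    rw [h3] at hp hq
    nlinarith

end IFS

/-! ### Tent functions and the projection onto piecewise affine functions -/

section Tent

variable {V : Finset ℝ} {a b δ : ℝ}

theorem mem_interior {i : ℕ} : i ∈ interior V ↔ 1 ≤ i ∧ i + 1 < V.card := by
  simp [interior]; omega

theorem tent_node {i j : ℕ} (hi : i ∈ interior V) (hj : j < V.card) :
    tent V i (node V j) = if i = j then 1 else 0 := by
  obtain ⟨h1, h2⟩ := mem_interior.1 hi
  have h01 : node V (i - 1) < node V i := node_lt_node (by omega) (by omega)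
  have h12 : node V i < node V (i + 1) := node_lt_node (by omega) h2
  unfold tent
  rcases lt_trichotomy i j with h | h | h
  · have h3 : node V (i + 1) ≤ node V j := node_le_node h hj
    rw [if_neg (by intro h; linarith [h.2]), if_neg h.ne]
    split_ifs with h4
    · rw [le_antisymm h4.2 h3]; simp
    · rfl
  · subst h
    rw [if_pos ⟨h01.le, le_rfl⟩, if_pos rfl, div_self (by linarith)]
  · have h3 : node V j ≤ node V (i - 1) := node_le_node (by omega) (by omega)
    rw [if_neg h.ne']
    split_ifs with h4 h5
    · rw [le_antisymm h3 h4.1]; simp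
    · linarith [h5.1]
    · rfl

theorem inner_indicator_Ioc {x y z w : ℝ} (hx : a ≤ x) (hy : y ≤ b) :
    inner ℝ (indicatorConstLp 2 (μ := volume.restrict (Ioo a b))
        (measurableSet_Ioc (a := z) (b := w)) (measure_ne_top _ _) (1 : ℝ))
      (indicatorConstLp 2 (μ := volume.restrict (Ioo a b)) (measurableSet_Ioc (a := x) (b := y))
        (measure_ne_top _ _) (1 : ℝ)) = max 0 (min w y - max z x) := by
  rw [L2.real_inner_indicatorConstLp_one_indicatorConstLp_one,
    Measure.restrict_congr_set Ioo_ae_eq_Ioc,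
    measureReal_restrict_apply (measurableSet_Ioc.inter measurableSet_Ioc), Ioc_inter_Ioc,
    inter_eq_left.2 (Ioc_subset_Ioc (hx.trans (le_max_right _ _)) ((min_le_right _ _).trans hy)),
    measureReal_def, Real.volume_Ioc, ENNReal.toReal_ofReal', max_comm]

/-- The tent functions belong to `H₀¹(a,b)`, and pairing with them in the energy form is taking a
second difference. -/
theorem exists_H01_tent (hab : a < b) (hV : IsMesh V a b δ) {i : ℕ} (hi : i ∈ interior V) :
    ∃ Φ : H01 a b, (∀ x, contRep a b Φ x = tent V i x) ∧
      ∀ v : H01 a b, energy v Φ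
        = (contRep a b v (node V i) - contRep a b v (node V (i - 1))) / (node V i - node V (i - 1))
          - (contRep a b v (node V (i + 1)) - contRep a b v (node V i))
            / (node V (i + 1) - node V i) := by
  obtain ⟨h1, h2⟩ := mem_interior.1 hi
  have h01 : node V (i - 1) < node V i := node_lt_node (by omega) (by omega)
  have h12 : node V i < node V (i + 1) := node_lt_node (by omega) h2
  have hx0 := (hV.subset _ (node_mem (V := V) (i := i - 1) (by omega))).1
  have hx2 := (hV.subset _ (node_mem (V := V) (i := i + 1) (by omega))).2
  unfold tent
  set x₀ := node V (i - 1)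
  set x₁ := node V i
  set x₂ := node V (i + 1)
  let χ : ℝ → ℝ → L2 a b := fun x y => indicatorConstLp 2 (μ := volume.restrict (Ioo a b))
    (measurableSet_Ioc (a := x) (b := y)) (measure_ne_top _ _) (1 : ℝ)
  -- The slopes of the tent. Each piece has integral one, so the mean is zero.
  let p : L2 a b := (x₁ - x₀)⁻¹ • χ x₀ x₁ - (x₂ - x₁)⁻¹ • χ x₁ x₂
  have hχ : ∀ (q : L2 a b) {x y : ℝ}, x ≤ y →
      ∫ t in x..y, q t ∂(volume.restrict (Ioo a b)) = inner ℝ (χ x y) q := by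
    intro q x y hxy
    rw [L2.inner_indicatorConstLp_one, intervalIntegral.integral_of_le hxy]
  have hp : ∀ x ≥ a, inner ℝ (χ a x) p = (x₁ - x₀)⁻¹ * max 0 (min x x₁ - x₀)
      - (x₂ - x₁)⁻¹ * max 0 (min x x₂ - x₁) := by
    intro x hx
    simp only [p, inner_sub_right, inner_smul_right]
    rw [inner_indicator_Ioc hx0 (by linarith), inner_indicator_Ioc (by linarith) hx2,
      max_eq_right hx0, max_eq_right (by linarith : a ≤ x₁)]
  have hp0 : ∫ x in Ioo a b, p x = 0 := by
    have h := hχ p hab.le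
    rw [hp b hab.le, intervalIntegral.integral_of_le hab.le,
      Measure.restrict_restrict measurableSet_Ioc, inter_eq_right.2 Ioo_subset_Ioc_self,
      min_eq_right (by linarith), min_eq_right hx2, max_eq_right (by linarith),
      max_eq_right (by linarith), inv_mul_cancel₀ (by linarith), inv_mul_cancel₀ (by linarith),
      sub_self] at h
    exact h
  obtain ⟨Φ, hΦ⟩ := exists_weakDeriv_eq hab p hp0
  refine ⟨Φ, fun x => ?_, fun v => ?_⟩
  · rcases lt_or_ge x a with hx | hx
    · rw [contRep_of_le Φ hx.le, if_neg (by intro h; linarith [h.1]),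
        if_neg (by intro h; linarith [h.1])]
    rw [contRep_apply, hΦ, hχ p hx, hp x hx]
    split_ifs with h3 h4
    · rw [min_eq_left h3.2, min_eq_left (by linarith), max_eq_right (by linarith [h3.1]),
        max_eq_left (by linarith [h3.2])]
      field_simp
      ring
    · have h5 : x₁ - x₀ ≠ 0 := by linarith
      have h6 : x₂ - x₁ ≠ 0 := by linarith
      have h7 : x₁ - x₂ ≠ 0 := by linarith
      rw [min_eq_right h4.1, min_eq_left h4.2, max_eq_right (by linarith [h3]),
        max_eq_right (by linarith [h4.1])]
      rw [inv_mul_cancel₀ h5, ← neg_sub x₂ x₁, div_neg]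
      field_simp
      ring
    · rcases lt_or_ge x x₀ with h5 | h5
      · rw [max_eq_left (by linarith [min_le_left x x₁]),
          max_eq_left (by linarith [min_le_left x x₂])]
        simp
      · have h6 : x₁ < x := by
          by_contra! h
          exact h3 ⟨h5, h⟩
        have h7 : x₂ < x := by
          by_contra! h
          exact h4 ⟨h6.le, h⟩
        rw [min_eq_right h6.le, min_eq_right h7.le, max_eq_right (by linarith),
          max_eq_right (by linarith), inv_mul_cancel₀ (by linarith), inv_mul_cancel₀ (by linarith),
          sub_self]
  · rw [energy_eq_inner, hΦ, contRep_sub, contRep_sub, hχ _ h01.le, hχ _ h12.le]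
    simp only [p, inner_sub_right, inner_smul_right]
    rw [real_inner_comm (χ x₀ x₁), real_inner_comm (χ x₁ x₂)]
    ring

/-- The weak derivative as a bounded linear map. -/
noncomputable def weakDerivL (a b : ℝ) : H01 a b →L[ℝ] L2 a b :=
  (WithLp.sndL 2 ℝ (L2 a b) (L2 a b)).comp (H01Submodule a b).subtypeL

theorem weakDerivL_apply (u : H01 a b) : weakDerivL a b u = weakDeriv u := rfl

theorem weakDeriv_sum_smul (I : Finset ℕ) (c : ℕ → ℝ) (Φ : ℕ → H01 a b) :
    weakDeriv (∑ i ∈ I, c i • Φ i) = ∑ i ∈ I, c i • weakDeriv (Φ i) := by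
  simp only [← weakDerivL_apply, map_sum, map_smul]

theorem contRep_sum_smul (I : Finset ℕ) (c : ℕ → ℝ) (Φ : ℕ → H01 a b) (x : ℝ) :
    contRep a b (∑ i ∈ I, c i • Φ i) x = ∑ i ∈ I, c i * contRep a b (Φ i) x := by
  simp [map_sum, map_smul]

theorem energy_comm (u v : H01 a b) : energy u v = energy v u := by
  rw [energy_eq_inner, energy_eq_inner, real_inner_comm]

theorem energy_sum_smul (I : Finset ℕ) (c : ℕ → ℝ) (Φ : ℕ → H01 a b) (v : H01 a b) :
    energy v (∑ i ∈ I, c i • Φ i) = ∑ i ∈ I, c i * energy v (Φ i) := by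
  simp [energy_eq_inner, weakDeriv_sum_smul, inner_sum, inner_smul_right]

theorem energy_sub_left (u v w : H01 a b) : energy (u - v) w = energy u w - energy v w := by
  simp [energy_eq_inner, ← weakDerivL_apply, inner_sub_left]

theorem energy_sub_right (u v w : H01 a b) : energy u (v - w) = energy u v - energy u w := by
  simp [energy_eq_inner, ← weakDerivL_apply, inner_sub_right]

/-- `Φ` lifts the tent functions at the interior nodes of `V` to `H₀¹(a,b)`; energy pairings with
`Φ i` only see the values at the nodes. -/
structure IsTentBasis (V : Finset ℝ) (Φ : ℕ → H01 a b) : Prop where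
  contRep_eq : ∀ i ∈ interior V, ∀ x, contRep a b (Φ i) x = tent V i x
  energy_eq_zero : ∀ i ∈ interior V, ∀ v : H01 a b,
    (∀ j < V.card, contRep a b v (node V j) = 0) → energy v (Φ i) = 0

theorem exists_isTentBasis (hab : a < b) (hV : IsMesh V a b δ) :
    ∃ Φ : ℕ → H01 a b, IsTentBasis V Φ := by
  choose! Φ h1 h2 using fun i (hi : i ∈ interior V) => exists_H01_tent hab hV hi
  refine ⟨Φ, h1, fun i hi v hv => ?_⟩
  have := mem_interior.1 hi
  rw [h2 i hi v, hv i (by omega), hv (i - 1) (by omega), hv (i + 1) (by omega)]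
  simp

namespace IsTentBasis

variable {Φ : ℕ → H01 a b}

theorem contRep_sum_node (hΦ : IsTentBasis V Φ) (c : ℕ → ℝ) {j : ℕ} (hj : j < V.card) :
    contRep a b (∑ i ∈ interior V, c i • Φ i) (node V j) = if j ∈ interior V then c j else 0 := by
  rw [contRep_sum_smul, Finset.sum_congr rfl (fun i hi => by
    rw [hΦ.contRep_eq i hi, tent_node hi hj, mul_ite, mul_one, mul_zero])]
  simp

theorem eq_zero_of_sum_eq_zero (hΦ : IsTentBasis V Φ) {c : ℕ → ℝ}
    (h : ∑ i ∈ interior V, c i • Φ i = 0) {j : ℕ} (hj : j ∈ interior V) : c j = 0 := by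
  have h1 := hΦ.contRep_sum_node c (j := j) (by have := mem_interior.1 hj; omega)
  rw [h, if_pos hj] at h1
  simpa using h1.symm

/-- The projection `P_m v`, as an element of `H₀¹(a,b)`. -/
noncomputable def proj (V : Finset ℝ) (Φ : ℕ → H01 a b) (v : H01 a b) : H01 a b :=
  ∑ i ∈ interior V, contRep a b v (node V i) • Φ i

/-- At interior nodes this is the duality of tents and nodes; at the two end nodes both functions
vanish by the boundary condition. -/
theorem contRep_proj_node (hab : a < b) (hV : IsMesh V a b δ) (hΦ : IsTentBasis V Φ) (v : H01 a b)
    {j : ℕ} (hj : j < V.card) : contRep a b (v - proj V Φ v) (node V j) = 0 := by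
  rw [map_sub, BoundedContinuousFunction.sub_apply, proj, hΦ.contRep_sum_node _ hj]
  split_ifs with h
  · rw [sub_self]
  · rw [sub_zero]
    rw [mem_interior] at h
    rcases Nat.eq_zero_or_pos j with rfl | h0
    · rw [hV.node_zero, contRep_of_le _ le_rfl]
    · rw [show j = V.card - 1 by omega, hV.node_last, contRep_right hab]

/-- Galerkin orthogonality of interpolation: it makes the stiffness term of the exact solution that
of its interpolant, with no error. -/
theorem energy_proj (hab : a < b) (hV : IsMesh V a b δ) (hΦ : IsTentBasis V Φ) (v : H01 a b)
    {i : ℕ} (hi : i ∈ interior V) : energy (proj V Φ v) (Φ i) = energy v (Φ i) := by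
  have h := hΦ.energy_eq_zero i hi (v - proj V Φ v) fun j hj => hΦ.contRep_proj_node hab hV v hj
  rw [energy_sub_left] at h
  linarith

/-- Pythagoras, since the error is orthogonal to the projection. -/
theorem energyNorm_sub_proj_le (hab : a < b) (hV : IsMesh V a b δ) (hΦ : IsTentBasis V Φ)
    (v : H01 a b) : energyNorm (v - proj V Φ v) ≤ energyNorm v := by
  have h0 : energy (v - proj V Φ v) (proj V Φ v) = 0 := by
    rw [proj, energy_sum_smul, ← proj]
    refine Finset.sum_eq_zero fun i hi => ?_
    rw [energy_sub_left, hΦ.energy_proj hab hV v hi, sub_self, mul_zero]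
  have h1 : energy (v - proj V Φ v) (v - proj V Φ v)
      = energy v v - energy (proj V Φ v) (proj V Φ v) := by
    rw [energy_sub_right, h0, energy_sub_left, energy_comm (proj V Φ v) v]
    rw [energy_sub_left] at h0
    linarith
  rw [energy_self (proj V Φ v)] at h1
  refine Real.sqrt_le_sqrt ?_
  rw [h1]
  nlinarith [sq_nonneg (energyNorm (proj V Φ v))]

theorem abs_contRep_sub_proj_le (hab : a < b) (hV : IsMesh V a b δ) (hΦ : IsTentBasis V Φ)
    (v : H01 a b) (x : ℝ) :
    |contRep a b (v - proj V Φ v) x| ≤ Real.sqrt δ * energyNorm v := by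
  have hnn : 0 ≤ Real.sqrt δ * energyNorm v := mul_nonneg (Real.sqrt_nonneg _) (Real.sqrt_nonneg _)
  rcases lt_or_ge x a with hx | hx
  · rwa [contRep_of_le _ hx.le, abs_zero]
  rcases lt_or_ge b x with hx' | hx'
  · rwa [contRep_of_ge hab _ hx'.le, abs_zero]
  obtain ⟨i, hi, h1, h2⟩ := hV.exists_mem_Icc ⟨hx, hx'⟩
  have h3 := abs_contRep_sub_le (v - proj V Φ v) h1
  rw [hΦ.contRep_proj_node hab hV v (by omega), sub_zero] at h3
  refine h3.trans (mul_le_mul (Real.sqrt_le_sqrt ?_) (hΦ.energyNorm_sub_proj_le hab hV v)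
    (Real.sqrt_nonneg _) (Real.sqrt_nonneg _))
  linarith [hV.gap i hi]

end IsTentBasis

end Tent

/-! ### The energy estimate for a finite-dimensional wave equation -/

/-- Coefficients of a curve are continuous if its inner products with a linearly independent
family are. -/
theorem continuousOn_of_gram {ι H : Type*} [NormedAddCommGroup H] [InnerProductSpace ℝ H]
    {I : Finset ι} {p : ι → H} (hp : ∀ c : ι → ℝ, ∑ j ∈ I, c j • p j = 0 → ∀ j ∈ I, c j = 0)
    {S : Set ℝ} {f : ι → ℝ → ℝ}
    (hf : ∀ i ∈ I, ContinuousOn (fun t => ∑ j ∈ I, f j t * inner ℝ (p i) (p j)) S) :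
    ∀ j ∈ I, ContinuousOn (f j) S := by
  classical
  let A : (I → ℝ) →ₗ[ℝ] (I → ℝ) := Matrix.toLin' (Matrix.of fun i j : I => inner ℝ (p i) (p j))
  have hA : ∀ (c : I → ℝ) (i : I), A c i = ∑ j : I, c j * inner ℝ (p i) (p j) := by
    intro c i
    simp [A, Matrix.mulVec, dotProduct, mul_comm]
  -- A vector `c` in the kernel of the Gram matrix satisfies `‖∑ c j • p j‖² = 0`.
  have hinj : A.ker = ⊥ := by
    rw [LinearMap.ker_eq_bot']
    intro c hc
    have h1 : ∑ j : I, c j • p j = 0 := by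
      rw [← inner_self_eq_zero (𝕜 := ℝ), sum_inner]
      refine Finset.sum_eq_zero fun i _ => ?_
      rw [real_inner_smul_left, inner_sum]
      have := hA c i
      rw [hc] at this
      simp only [real_inner_smul_right, ← this, Pi.zero_apply, mul_zero]
    let c' : ι → ℝ := fun j => if h : j ∈ I then c ⟨j, h⟩ else 0
    have h2 : ∑ j ∈ I, c' j • p j = 0 := by
      rw [← Finset.sum_coe_sort I, ← h1]
      exact Finset.sum_congr rfl fun j _ => by simp [c']
    ext j
    have := hp c' h2 j j.2
    simpa [c'] using this
  obtain ⟨L, hL⟩ := A.exists_leftInverse_of_injective hinj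
  have hcont : ContinuousOn (fun t => A fun j : I => f j t) S := by
    rw [continuousOn_pi]
    intro i
    simp only [hA]
    refine (hf i i.2).congr fun t _ => ?_
    exact (Finset.sum_coe_sort I fun j => f j t * inner ℝ (p i) (p j))
  have h3 : ContinuousOn (fun t => fun j : I => f j t) S := by
    refine (L.continuous_of_finiteDimensional.comp_continuousOn hcont).congr fun t _ => ?_
    exact (LinearMap.congr_fun hL fun j : I => f j t).symm
  intro j hj
  exact (continuousOn_pi.1 h3) ⟨j, hj⟩

/-- Here `γ`, `z`, `f` are the coefficients of position, velocity and acceleration, and the Gram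
matrices of `p` and `q` are the mass and stiffness matrices. The energy `G` has derivative `2 ⟨R,
velocity⟩`. -/
theorem energy_estimate {ι H₁ H₂ : Type*} [NormedAddCommGroup H₁] [InnerProductSpace ℝ H₁]
    [NormedAddCommGroup H₂] [InnerProductSpace ℝ H₂] {T : ℝ} (hT : 0 ≤ T) {I : Finset ι}
    {p : ι → H₁} {q : ι → H₂} {γ z f : ι → ℝ → ℝ}
    (hγ : ∀ i ∈ I, IsPrimitive T (γ i) (z i)) (hz : ∀ i ∈ I, IsPrimitive T (z i) (f i))
    (hγ0 : ∀ i ∈ I, γ i 0 = 0) (hz0 : ∀ i ∈ I, z i 0 = 0)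
    {R : ℝ → H₁} {κ : ℝ → ℝ} (hκ : IntegrableOn κ (Ioo 0 T))
    (hR : ∀ᵐ t ∂(volume.restrict (Ioo 0 T)), ‖R t‖ ≤ κ t)
    (heq : ∀ᵐ t ∂(volume.restrict (Ioo 0 T)), ∀ i ∈ I,
      ∑ j ∈ I, f j t * inner ℝ (p i) (p j) + ∑ j ∈ I, γ j t * inner ℝ (q i) (q j)
        = inner ℝ (R t) (p i)) {t : ℝ} (ht : t ∈ Icc 0 T) :
    ‖∑ j ∈ I, γ j t • q j‖ ≤ 2 * ∫ s in Ioo 0 T, κ s := by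
  let G : ℝ → ℝ := fun t => ∑ i ∈ I, ∑ j ∈ I, inner ℝ (p i) (p j) * (z i t * z j t)
    + ∑ i ∈ I, ∑ j ∈ I, inner ℝ (q i) (q j) * (γ i t * γ j t)
  have hG : ∀ t, G t = ‖∑ j ∈ I, z j t • p j‖ ^ 2 + ‖∑ j ∈ I, γ j t • q j‖ ^ 2 := by
    intro t
    simp only [G, ← real_inner_self_eq_norm_sq, sum_inner, inner_sum, real_inner_smul_left,
      real_inner_smul_right]
    congr 1 <;> exact Finset.sum_congr rfl fun i _ => Finset.sum_congr rfl fun j _ => by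
      rw [real_inner_comm]; ring
  let g : ℝ → ℝ := fun t => ∑ i ∈ I, ∑ j ∈ I, inner ℝ (p i) (p j) * (f i t * z j t + z i t * f j t)
    + ∑ i ∈ I, ∑ j ∈ I, inner ℝ (q i) (q j) * (z i t * γ j t + γ i t * z j t)
  have hprim : IsPrimitive T G g :=
    (IsPrimitive.sum I fun i hi => IsPrimitive.sum I fun j hj =>
      ((hz i hi).mul hT (hz j hj)).const_mul _).add
    (IsPrimitive.sum I fun i hi => IsPrimitive.sum I fun j hj =>
      ((hγ i hi).mul hT (hγ j hj)).const_mul _)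
  have hg : ∀ᵐ t ∂(volume.restrict (Ioo 0 T)),
      g t = 2 * inner ℝ (R t) (∑ i ∈ I, z i t • p i) := by
    filter_upwards [heq] with t ht
    have h1 : ∑ i ∈ I, ∑ j ∈ I, inner ℝ (p i) (p j) * (f i t * z j t + z i t * f j t)
        = 2 * ∑ i ∈ I, ∑ j ∈ I, z i t * (f j t * inner ℝ (p i) (p j)) := by
      simp only [mul_add, Finset.sum_add_distrib, two_mul]
      congr 1
      · rw [Finset.sum_comm]
        exact Finset.sum_congr rfl fun i _ => Finset.sum_congr rfl fun j _ => by
          rw [real_inner_comm]; ring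
      · exact Finset.sum_congr rfl fun i _ => Finset.sum_congr rfl fun j _ => by ring
    have h2 : ∑ i ∈ I, ∑ j ∈ I, inner ℝ (q i) (q j) * (z i t * γ j t + γ i t * z j t)
        = 2 * ∑ i ∈ I, ∑ j ∈ I, z i t * (γ j t * inner ℝ (q i) (q j)) := by
      simp only [mul_add, Finset.sum_add_distrib, two_mul]
      congr 1
      · exact Finset.sum_congr rfl fun i _ => Finset.sum_congr rfl fun j _ => by ring
      · rw [Finset.sum_comm]
        exact Finset.sum_congr rfl fun i _ => Finset.sum_congr rfl fun j _ => by
          rw [real_inner_comm]; ring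
    simp only [g]
    rw [h1, h2, ← mul_add, ← Finset.sum_add_distrib, inner_sum]
    congr 1
    refine Finset.sum_congr rfl fun i hi => ?_
    rw [← Finset.mul_sum, ← Finset.mul_sum, ← mul_add, ht i hi, real_inner_smul_right]
  have hG0 : G 0 = 0 := by
    rw [hG, Finset.sum_eq_zero (fun i hi => by rw [hz0 i hi, zero_smul]),
      Finset.sum_eq_zero (fun i hi => by rw [hγ0 i hi, zero_smul])]
    simp
  -- At a maximum point of the energy, `Y = √(G τ)` bounds the velocity on all of `[0,T]`. Then `Y²
  -- ≤ 2 Y ∫ κ`, and one factor `Y` is cancelled without a Gronwall argument.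
  obtain ⟨τ, hτ, hmax⟩ := isCompact_Icc.exists_isMaxOn (nonempty_Icc.2 hT) (hprim.continuousOn hT)
  set Y := Real.sqrt (G τ) with hY
  have hGnn : ∀ t, 0 ≤ G t := fun t => by rw [hG]; positivity
  have hYnn : 0 ≤ Y := Real.sqrt_nonneg _
  have hYsq : Y ^ 2 = G τ := Real.sq_sqrt (hGnn τ)
  have hle : ∀ s ∈ Icc 0 T, G s ≤ Y ^ 2 := fun s hs => hYsq ▸ hmax hs
  have hzY : ∀ s ∈ Icc 0 T, ‖∑ j ∈ I, z j s • p j‖ ≤ Y := fun s hs =>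
    abs_le_of_sq_le_sq' (by
      have := hle s hs
      rw [hG] at this
      nlinarith [sq_nonneg ‖∑ j ∈ I, γ j s • q j‖]) hYnn |>.2
  have hγY : ‖∑ j ∈ I, γ j t • q j‖ ≤ Y :=
    abs_le_of_sq_le_sq' (by
      have := hle t ht
      rw [hG] at this
      nlinarith [sq_nonneg ‖∑ j ∈ I, z j t • p j‖]) hYnn |>.2
  refine hγY.trans ?_
  have hsub : Ioo 0 τ ⊆ Ioo 0 T := Ioo_subset_Ioo_right hτ.2
  have hκnn : 0 ≤ᵐ[volume.restrict (Ioo 0 T)] κ := by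
    filter_upwards [hR] with s hs using (norm_nonneg _).trans hs
  have hbound : Y ^ 2 ≤ 2 * Y * ∫ s in Ioo 0 T, κ s := by
    rw [hYsq, hprim.2 τ hτ, hG0, zero_add, intervalIntegral.integral_of_le hτ.1,
      integral_Ioc_eq_integral_Ioo]
    have hgi : IntegrableOn g (Ioo 0 τ) :=
      ((intervalIntegrable_iff_integrableOn_Ioo_of_le hT).1 hprim.1).mono_set hsub
    calc ∫ s in Ioo 0 τ, g s ≤ ∫ s in Ioo 0 τ, 2 * Y * κ s := by
          refine integral_mono_ae hgi ((hκ.mono_set hsub).const_mul _) ?_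
          filter_upwards [ae_restrict_of_ae_restrict_of_subset hsub hg,
            ae_restrict_of_ae_restrict_of_subset hsub hR,
            ae_restrict_mem measurableSet_Ioo] with s h1 h2 h3
          have h4 := hzY s ⟨h3.1.le, (hsub h3).2.le⟩
          have h5 := (real_inner_le_norm (R s) (∑ i ∈ I, z i s • p i)).trans
            (mul_le_mul h2 h4 (norm_nonneg _) ((norm_nonneg _).trans h2))
          rw [h1]; linarith
      _ ≤ ∫ s in Ioo 0 T, 2 * Y * κ s := by
          refine setIntegral_mono_set (hκ.const_mul _) ?_ hsub.eventuallyLE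
          filter_upwards [hκnn] with s hs
          exact mul_nonneg (by positivity) hs
      _ = _ := integral_const_mul _ _
  rcases hYnn.eq_or_lt with h0 | h0
  · rw [← h0]
    exact mul_nonneg (by norm_num) (integral_nonneg_of_ae hκnn)
  · refine le_of_mul_le_mul_left ?_ h0
    nlinarith

/-! ### The form domain and regular weak solutions -/

section FormDomain

variable {a b : ℝ} {μ : Measure ℝ} [IsFiniteMeasure μ]

instance : CompleteSpace (H01 a b) :=
  (Submodule.isClosed_topologicalClosure _).completeSpace_coe

noncomputable instance : NormedAddCommGroup (DomE a b μ) := inferInstance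

noncomputable instance : NormedSpace ℝ (DomE a b μ) := inferInstance

instance : CompleteSpace (DomE a b μ) :=
  (Submodule.isClosed_orthogonal _).completeSpace_coe

theorem iota_coeFn (v : H01 a b) : (iota a b μ v : ℝ → ℝ) =ᵐ[μ] contRep a b v :=
  BoundedContinuousFunction.coeFn_toLp (p := 2) (𝕜 := ℝ) _ _

theorem norm_iota_le [IsProbabilityMeasure μ] {v : H01 a b} {M : ℝ} (hM : 0 ≤ M)
    (h : ∀ x, |contRep a b v x| ≤ M) : ‖iota a b μ v‖ ≤ M := by
  have := Lp.norm_le_of_ae_bound (f := iota a b μ v) hM (by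
    filter_upwards [iota_coeFn v] with x hx
    rw [hx]; exact h x)
  simpa [measureUnivNNReal] using this

/-- The open set where the continuous representative is nonzero is μ-null and hence misses the
support. -/
theorem eq_zero_of_iota_eq_zero (hsupp : μ.support = Icc a b) {v : H01 a b}
    (hv : iota a b μ v = 0) : v = 0 := by
  refine eq_zero_of_contRep_eq_zero fun x hx => ?_
  have h0 : (contRep a b v : ℝ → ℝ) =ᵐ[μ] 0 := by
    refine (iota_coeFn v).symm.trans ?_
    rw [hv]; exact Lp.coeFn_zero _ _ _
  by_contra hne
  have hopen : IsOpen {y | contRep a b v y ≠ 0} :=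
    isOpen_ne_fun (contRep a b v).continuous continuous_const
  have hsub := Measure.subset_compl_support_of_isOpen hopen (μ := μ) (ae_iff.1 h0)
  exact hsub hne (hsupp ▸ Ioo_subset_Icc_self hx)

theorem mem_domSubmodule (hsupp : μ.support = Icc a b) (v : H01 a b) : v ∈ domSubmodule a b μ := by
  have : (iota a b μ).ker = ⊥ := by
    rw [LinearMap.ker_eq_bot']
    exact fun v hv => eq_zero_of_iota_eq_zero hsupp hv
  rw [domSubmodule, this, Submodule.bot_orthogonal_eq_top]
  trivial

theorem embed_injective {v : DomE a b μ} (hv : embed a b μ v = 0) : v = 0 := by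
  have h1 : (v : H01 a b) ∈ (iota a b μ).ker := hv
  exact Subtype.ext (inner_self_eq_zero (𝕜 := ℝ).1 ((Submodule.mem_orthogonal _ _).1 v.2 _ h1))

/-- Applying a functional to a weak derivative. -/
theorem IsWeakTimeDeriv.apply {X : Type*} [NormedAddCommGroup X] [NormedSpace ℝ X]
    [CompleteSpace X] {T : ℝ} {u v : ℝ → X} (h : IsWeakTimeDeriv T u v) (ℓ : X →L[ℝ] ℝ) {φ : ℝ → ℝ}
    (hφ : IsTest 0 T φ) :
    ∫ t in Ioo 0 T, deriv φ t * ℓ (u t) = -∫ t in Ioo 0 T, φ t * ℓ (v t) := by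
  have hb : ∀ {ψ : ℝ → ℝ} {w : ℝ → X}, Continuous ψ → HasCompactSupport ψ →
      IntegrableOn w (Ioo 0 T) →
      IntegrableOn (fun t => ψ t • w t) (Ioo 0 T) := by
    intro ψ w hc hs hw
    obtain ⟨M, hM⟩ := hs.exists_bound_of_continuous hc
    exact hw.bdd_smul M hc.aestronglyMeasurable (Eventually.of_forall hM)
  have h1 := congrArg ℓ (h.2.2 φ hφ)
  rw [map_neg, ← ℓ.integral_comp_comm
    (hb (hφ.1.continuous_deriv (by simp)) hφ.2.1.deriv h.1),
    ← ℓ.integral_comp_comm (hb hφ.1.continuous hφ.2.1 h.2.1)] at h1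
  simpa using h1

theorem IsWeakTimeDeriv.isPrimitive {X : Type*} [NormedAddCommGroup X] [NormedSpace ℝ X]
    [CompleteSpace X] {T : ℝ} (hT : 0 < T) {u v : ℝ → X} (h : IsWeakTimeDeriv T u v)
    (hu : ContinuousOn u (Icc 0 T)) (ℓ : X →L[ℝ] ℝ) :
    IsPrimitive T (fun t => ℓ (u t)) fun t => ℓ (v t) :=
  IsPrimitive.of_weak hT (ℓ.continuous.comp_continuousOn hu) (ℓ.integrable_comp h.2.1)
    fun _ hφ => h.apply ℓ hφ

theorem IsWeakTimeDeriv.isPrimitive_dual {X : Type*} [NormedAddCommGroup X] [NormedSpace ℝ X]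
    {T : ℝ} (hT : 0 < T) {u v : ℝ → StrongDual ℝ X} (h : IsWeakTimeDeriv T u v)
    (hu : ContinuousOn u (Icc 0 T)) (x : X) :
    IsPrimitive T (fun t => u t x) fun t => v t x :=
  h.isPrimitive hT hu (ContinuousLinearMap.apply ℝ ℝ x)

theorem isPrimitive_clm_apply {X : Type*} [NormedAddCommGroup X] [NormedSpace ℝ X]
    [CompleteSpace X] {T : ℝ} {w : ℝ → X} (hw : IntervalIntegrable w volume 0 T) (x : X)
    (ℓ : X →L[ℝ] ℝ) :
    IsPrimitive T (fun t => ℓ (x + ∫ s in (0 : ℝ)..t, w s)) fun t => ℓ (w t) := by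
  refine ⟨⟨ℓ.integrable_comp hw.1, ℓ.integrable_comp hw.2⟩, fun t ht => ?_⟩
  have hwt : IntervalIntegrable w volume 0 t := hw.mono_set (by
    rw [uIcc_of_le ht.1, uIcc_of_le (ht.1.trans ht.2)]; exact Icc_subset_Icc_right ht.2)
  rw [ℓ.intervalIntegral_comp_comm hwt]
  simp

/-- If the second weak derivative of `u` in the triple `X ↪ H ↪ X'` is an integrable function `w`
with values in `X`, then `u = g + ∫₀ᵗ (h + ∫₀ˢ w)`. -/
theorem eq_integral_of_isWeakTimeDeriv {X H : Type*} [NormedAddCommGroup X] [NormedSpace ℝ X]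
    [CompleteSpace X] [NormedAddCommGroup H] [InnerProductSpace ℝ H] [CompleteSpace H]
    {ι : X →L[ℝ] H} (hι : ∀ x, ι x = 0 → x = 0) {T : ℝ} (hT : 0 < T) {g h : X}
    {u w : ℝ → X} {u₁ : ℝ → H} {u₂ : ℝ → StrongDual ℝ X}
    (hd : IsWeakTimeDeriv T (fun t => ι (u t)) u₁)
    (hd₁ : IsWeakTimeDeriv T (fun t => (innerSL ℝ (u₁ t)).comp ι) u₂)
    (hc : ContinuousOn (fun t => ι (u t)) (Icc 0 T))
    (hc₁ : ContinuousOn (fun t => (innerSL ℝ (u₁ t)).comp ι) (Icc 0 T))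
    (h0 : u 0 = g) (h1' : u₁ 0 = ι h) (hw : IntegrableOn w (Ioo 0 T))
    (hwu : ∀ᵐ t ∂(volume.restrict (Ioo 0 T)), (innerSL ℝ (ι (w t))).comp ι = u₂ t) :
    ∀ t ∈ Icc 0 T, u t = g + ∫ s in (0 : ℝ)..t, (h + ∫ τ in (0 : ℝ)..s, w τ) := by
  have hwi : IntervalIntegrable w volume 0 T :=
    (intervalIntegrable_iff_integrableOn_Ioo_of_le hT.le).2 hw
  set W : ℝ → X := fun s => h + ∫ τ in (0 : ℝ)..s, w τ with hW
  have hWc : ContinuousOn W (Icc 0 T) := by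
    refine continuousOn_const.add ?_
    have := intervalIntegral.continuousOn_primitive_interval (μ := volume) (f := w)
      (a := 0) (b := T)
      (by rw [uIcc_of_le hT.le, integrableOn_Icc_iff_integrableOn_Ioo]; exact hw)
    rwa [uIcc_of_le hT.le] at this
  have hWi : IntervalIntegrable W volume 0 T :=
    ContinuousOn.intervalIntegrable (by rwa [uIcc_of_le hT.le])
  -- Both sides are primitives with the same a.e. integrand and initial value. Only vectors `ι v`
  -- can be tested, because `u₁` is continuous merely as a functional on `X`.
  have key1 : ∀ v : X, ∀ t ∈ Icc 0 T,
      inner ℝ (u₁ t) (ι v) = inner ℝ (ι (W t)) (ι v) := by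
    intro v
    let ℓ : X →L[ℝ] ℝ := (innerSL ℝ (ι v)).comp (ι)
    have h1 := hd₁.isPrimitive_dual hT hc₁ v
    have h2 := isPrimitive_clm_apply hwi h ℓ
    intro t ht
    have h3 := h1.2 t ht
    have h4 := h2.2 t ht
    have h5 : ∫ s in (0 : ℝ)..t, u₂ s v = ∫ s in (0 : ℝ)..t, ℓ (w s) := by
      rw [intervalIntegral.integral_of_le ht.1, intervalIntegral.integral_of_le ht.1,
        integral_Ioc_eq_integral_Ioo, integral_Ioc_eq_integral_Ioo]
      refine integral_congr_ae ?_
      filter_upwards [ae_restrict_of_ae_restrict_of_subset (Ioo_subset_Ioo_right ht.2) hwu]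
        with s hs
      rw [← hs]
      exact real_inner_comm _ _
    have h6 : ((innerSL ℝ (u₁ 0)).comp ι) v = ℓ h := by
      rw [h1']; exact real_inner_comm _ _
    beta_reduce at h3
    rw [h5, h6] at h3
    simp only [intervalIntegral.integral_same, add_zero] at h4
    rw [real_inner_comm (ι v) (ι (W t))]
    exact h3.trans h4.symm
  intro t ht
  set U := g + ∫ s in (0 : ℝ)..t, W s with hU
  have key2 : ∀ v : X, inner ℝ (ι v) (ι (u t))
      = inner ℝ (ι v) (ι U) := by
    intro v
    let ℓ : H →L[ℝ] ℝ := innerSL ℝ (ι v)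
    have h1 := hd.isPrimitive hT hc ℓ
    let ℓ' : X →L[ℝ] ℝ := ℓ.comp (ι)
    have h2 := isPrimitive_clm_apply hWi g ℓ'
    have h3 := h1.2 t ht
    have h4 := h2.2 t ht
    have h5 : ∫ s in (0 : ℝ)..t, ℓ (u₁ s) = ∫ s in (0 : ℝ)..t, ℓ (ι (W s)) := by
      refine intervalIntegral.integral_congr fun s hs => ?_
      rw [uIcc_of_le ht.1] at hs
      have := key1 v s ⟨hs.1, hs.2.trans ht.2⟩
      rw [real_inner_comm, real_inner_comm (ι v)] at this
      exact this
    beta_reduce at h3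
    rw [h5, h0] at h3
    simp only [intervalIntegral.integral_same, add_zero] at h4
    exact h3.trans h4.symm
  -- Testing `key2` with `v = u t - U` shows `‖ι (u t - U)‖² = 0`.
  rw [← sub_eq_zero]
  refine hι _ ?_
  rw [← inner_self_eq_zero (𝕜 := ℝ)]
  nth_rewrite 2 [map_sub]
  rw [inner_sub_right, key2, sub_self]

end FormDomain

/-! ### The error estimate -/

variable {a b δ : ℝ} {μ : Measure ℝ} [IsFiniteMeasure μ] {V : Finset ℝ} {Φ : ℕ → H01 a b}

theorem inner_iota (v w : H01 a b) :
    inner ℝ (iota a b μ v) (iota a b μ w) = ∫ x, contRep a b v x * contRep a b w x ∂μ := by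
  rw [L2.inner_def]
  refine integral_congr_ae ?_
  filter_upwards [iota_coeFn (μ := μ) v, iota_coeFn (μ := μ) w] with x h1 h2
  rw [h1, h2]
  simp [mul_comm]

namespace IsTentBasis

theorem setIntegral_tent_mul (hΦ : IsTentBasis V Φ) (hsupp : μ.support = Icc a b)
    {i j : ℕ} (hi : i ∈ interior V) (hj : j ∈ interior V) :
    ∫ x in Icc a b, tent V i x * tent V j x ∂μ
      = inner ℝ (iota a b μ (Φ i)) (iota a b μ (Φ j)) := by
  rw [inner_iota, setIntegral_eq_integral_of_ae_compl_eq_zero]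
  · simp only [hΦ.contRep_eq i hi, hΦ.contRep_eq j hj]
  · filter_upwards [Measure.support_mem_ae (μ := μ)] with x hx hx'
    exact absurd (hsupp ▸ hx) hx'

theorem setIntegral_deriv_tent_mul (hΦ : IsTentBasis V Φ)
    {i j : ℕ} (hi : i ∈ interior V) (hj : j ∈ interior V) :
    ∫ x in Icc a b, deriv (tent V i) x * deriv (tent V j) x
      = inner ℝ (weakDeriv (Φ i)) (weakDeriv (Φ j)) := by
  rw [← energy_eq_inner, energy, integral_Icc_eq_integral_Ioo]
  refine integral_congr_ae ?_
  filter_upwards [weakDeriv_ae_eq_deriv (Φ i), weakDeriv_ae_eq_deriv (Φ j)] with x h1 h2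
  rw [h1, h2, show (contRep a b (Φ i) : ℝ → ℝ) = tent V i from funext (hΦ.contRep_eq i hi),
    show (contRep a b (Φ j) : ℝ → ℝ) = tent V j from funext (hΦ.contRep_eq j hj)]

theorem norm_iota_proj_sub_le [IsProbabilityMeasure μ] (hab : a < b) (hV : IsMesh V a b δ)
    (hΦ : IsTentBasis V Φ) (v : H01 a b) :
    ‖iota a b μ (proj V Φ v - v)‖ ≤ Real.sqrt δ * energyNorm v := by
  refine norm_iota_le (mul_nonneg (Real.sqrt_nonneg _) (Real.sqrt_nonneg _)) fun x => ?_
  rw [← neg_sub, map_neg, BoundedContinuousFunction.neg_apply, abs_neg]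
  exact hΦ.abs_contRep_sub_proj_le hab hV v x

end IsTentBasis

theorem continuous_energyNorm : Continuous (energyNorm : H01 a b → ℝ) := by
  have : (energyNorm : H01 a b → ℝ) = fun u => ‖weakDerivL a b u‖ := funext energyNorm_eq_norm
  rw [this]
  fun_prop

/-- The finite element error is controlled by the time integral of `‖u_tt‖` in `Dom E`. -/
theorem abs_ritz_sub_femFun_le [IsProbabilityMeasure μ] (hab : a < b)
    (hsupp : μ.support = Icc a b) (hV : IsMesh V a b δ) {T : ℝ} (hT : 0 < T) {g h : DomE a b μ}
    {u : ℝ → DomE a b μ} {u₁ : ℝ → Lp ℝ 2 μ} {u₂ : ℝ → StrongDual ℝ (DomE a b μ)}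
    (hu : IsWeakSolution a b μ T 0 g (embed a b μ h) u u₁ u₂) {β : ℕ → ℝ → ℝ}
    (hβ : IsFEMSolution a b μ T V (contRep a b (g : H01 a b)) (contRep a b (h : H01 a b)) β)
    {w : ℝ → DomE a b μ} (hw : IntegrableOn w (Ioo 0 T))
    (hwu : ∀ᵐ t ∂(volume.restrict (Ioo 0 T)), toDual (embed a b μ (w t)) = u₂ t)
    {t : ℝ} (ht : t ∈ Icc 0 T) (x : ℝ) :
    |ritz V (contRep a b (u t : H01 a b)) x - femFun V β t x|
      ≤ Real.sqrt (b - a) *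
        (2 * ∫ s in Ioo 0 T, Real.sqrt δ * energyNorm (w s : H01 a b)) := by
  obtain ⟨Φ, hΦ⟩ := exists_isTentBasis hab hV
  obtain ⟨β₁, β₂, hβ₁, hβ₂, hfem, hinit⟩ := hβ
  set I := interior V with hI
  let p : ℕ → Lp ℝ 2 μ := fun i => iota a b μ (Φ i)
  let q : ℕ → L2 a b := fun i => weakDeriv (Φ i)
  have hp : ∀ c : ℕ → ℝ, ∑ j ∈ I, c j • p j = 0 → ∀ j ∈ I, c j = 0 := by
    intro c hc j hj
    have h1 : iota a b μ (∑ j ∈ I, c j • Φ j) = 0 := by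
      simpa only [map_sum, map_smul] using hc
    exact hΦ.eq_zero_of_sum_eq_zero (eq_zero_of_iota_eq_zero hsupp h1) hj
  have hfem' : ∀ i ∈ I, ∀ t ∈ Icc 0 T, ∑ j ∈ I, β₂ j t * inner ℝ (p i) (p j)
      = -∑ j ∈ I, β j t * inner ℝ (q i) (q j) := by
    intro i hi t ht
    have h1 := hfem i hi t ht
    refine ((Finset.sum_congr rfl fun j hj => ?_).trans h1).trans
      (congrArg Neg.neg (Finset.sum_congr rfl fun j hj => ?_))
    · rw [hΦ.setIntegral_tent_mul hsupp hi hj]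
    · rw [hΦ.setIntegral_deriv_tent_mul hi hj]
  -- Continuity of the second derivatives is not part of the finite element system. It follows by
  -- inverting the mass matrix, which is nonsingular by `hp`.
  have hβ₂c : ∀ j ∈ I, ContinuousOn (β₂ j) (Icc 0 T) := by
    refine continuousOn_of_gram hp fun i hi => ?_
    refine ContinuousOn.congr ?_ (hfem' i hi)
    refine (continuousOn_finsetSum _ fun j hj => ?_).neg
    exact ContinuousOn.mul (fun t ht => (hβ₁ j hj t ht).continuousWithinAt) continuousOn_const
  have hPβ : ∀ j ∈ I, IsPrimitive T (β j) (β₁ j) := fun j hj =>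
    IsPrimitive.of_hasDerivWithinAt hT.le (hβ₁ j hj)
      fun t ht => (hβ₂ j hj t ht).continuousWithinAt
  have hPβ₁ : ∀ j ∈ I, IsPrimitive T (β₁ j) (β₂ j) := fun j hj =>
    IsPrimitive.of_hasDerivWithinAt hT.le (hβ₂ j hj) (hβ₂c j hj)
  set W : ℝ → DomE a b μ := fun s => h + ∫ τ in (0 : ℝ)..s, w τ with hW
  have hrep : ∀ t ∈ Icc 0 T, u t = g + ∫ s in (0 : ℝ)..t, W s :=
    eq_integral_of_isWeakTimeDeriv (X := DomE a b μ) (ι := embed a b μ)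
      (fun _ => embed_injective) hT hu.deriv_u hu.deriv_ut hu.continuousOn_u hu.continuousOn_ut
      hu.initial_u hu.initial_ut hw hwu
  have hwi : IntervalIntegrable w volume 0 T :=
    (intervalIntegrable_iff_integrableOn_Ioo_of_le hT.le).2 hw
  have hWi : IntervalIntegrable W volume 0 T := by
    refine ContinuousOn.intervalIntegrable (continuousOn_const.add ?_)
    exact intervalIntegral.continuousOn_primitive_interval
      (by rw [uIcc_of_le hT.le, integrableOn_Icc_iff_integrableOn_Ioo]; exact hw)
  -- Evaluation at a node is bounded on `DomE`, so it commutes with the `DomE`-valued integrals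
  -- representing `u`.
  let ℓ : ℕ → (DomE a b μ →L[ℝ] ℝ) := fun j => (BoundedContinuousFunction.evalCLM ℝ (node V j)).comp
    ((contRep a b).comp (domSubmodule a b μ).subtypeL)
  have hℓ : ∀ j (v : DomE a b μ), ℓ j v = contRep a b (v : H01 a b) (node V j) := fun _ _ => rfl
  have hα : ∀ j, IsPrimitive T (fun t => ℓ j (g + ∫ s in (0 : ℝ)..t, W s)) fun t => ℓ j (W t) :=
    fun j => isPrimitive_clm_apply (X := DomE a b μ) hWi g (ℓ j)
  have hα₁ : ∀ j, IsPrimitive T (fun t => ℓ j (W t)) fun t => ℓ j (w t) :=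
    fun j => isPrimitive_clm_apply (X := DomE a b μ) hwi h (ℓ j)
  let γ : ℕ → ℝ → ℝ := fun j t => ℓ j (g + ∫ s in (0 : ℝ)..t, W s) - β j t
  have hκ : IntegrableOn (fun s => Real.sqrt δ * energyNorm (w s : H01 a b)) (Ioo 0 T) := by
    have : ∀ v : DomE a b μ, energyNorm (v : H01 a b)
        = ‖(weakDerivL a b).comp (domSubmodule a b μ).subtypeL v‖ := fun v => energyNorm_eq_norm _
    simp only [this]
    exact (ContinuousLinearMap.integrable_comp (H := DomE a b μ) _ hw).norm.const_mul _
  have hmain := energy_estimate hT.le (p := p) (q := q) (γ := γ)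
    (z := fun j t => ℓ j (W t) - β₁ j t) (f := fun j t => ℓ j (w t) - β₂ j t)
    (fun j hj => (hα j).sub (hPβ j hj)) (fun j hj => (hα₁ j).sub (hPβ₁ j hj))
    (fun j hj => by simp [γ, hℓ, (hinit j hj).1]) (fun j hj => by simp [hW, hℓ, (hinit j hj).2])
    -- The residual is the interpolation error of `u_tt`.
    (R := fun t => iota a b μ (IsTentBasis.proj V Φ (w t) - (w t : H01 a b))) hκ
    (Eventually.of_forall fun t => hΦ.norm_iota_proj_sub_le hab hV _) ?_ ht
  · have hγt : ritz V (contRep a b (u t : H01 a b)) x - femFun V β t x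
        = contRep a b (∑ j ∈ I, γ j t • Φ j) x := by
      rw [contRep_sum_smul, ritz, femFun, ← Finset.sum_sub_distrib]
      refine Finset.sum_congr rfl fun j hj => ?_
      rw [hΦ.contRep_eq j hj, hrep t ht, ← hℓ]
      simp only [γ]
      ring
    rw [hγt]
    refine (abs_contRep_le hab _ x).trans (mul_le_mul_of_nonneg_left ?_ (Real.sqrt_nonneg _))
    rw [energyNorm_eq_norm, weakDeriv_sum_smul]
    exact hmain
  · have heqn : ∀ᵐ t ∂(volume.restrict (Ioo 0 T)), ∀ i ∈ I,
        u₂ t ⟨Φ i, mem_domSubmodule hsupp _⟩ + energy (u t : H01 a b) (Φ i) = 0 := by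
      rw [Finset.eventually_all]
      intro i hi
      filter_upwards [hu.equation ⟨Φ i, mem_domSubmodule hsupp _⟩] with t ht
      simpa using ht
    filter_upwards [heqn, hwu, ae_restrict_mem measurableSet_Ioo] with t h1 h2 h3 i hi
    have ht : t ∈ Icc 0 T := Ioo_subset_Icc_self h3
    have h4 := h1 i hi
    have h5 : u₂ t ⟨Φ i, mem_domSubmodule hsupp _⟩
        = inner ℝ (iota a b μ (w t : H01 a b)) (p i) := by
      rw [← h2]; rfl
    rw [h5] at h4
    -- Galerkin orthogonality replaces `u` by its interpolant here.
    have h6 : ∑ j ∈ I, ℓ j (g + ∫ s in (0 : ℝ)..t, W s) * inner ℝ (q i) (q j)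
        = energy (u t : H01 a b) (Φ i) := by
      rw [← hΦ.energy_proj hab hV _ hi, energy_comm, IsTentBasis.proj, energy_sum_smul, hrep t ht]
      exact Finset.sum_congr rfl fun j hj => by rw [energy_eq_inner, hℓ]
    have h7 : ∑ j ∈ I, ℓ j (w t) * inner ℝ (p i) (p j)
        = inner ℝ (iota a b μ (IsTentBasis.proj V Φ (w t))) (p i) := by
      rw [real_inner_comm, IsTentBasis.proj, map_sum, inner_sum]
      refine Finset.sum_congr rfl fun j hj => ?_
      rw [map_smul, real_inner_smul_right, hℓ]
    have h8 := hfem' i hi t ht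
    simp only [γ, sub_mul, Finset.sum_sub_distrib]
    rw [h6, h7, h8, map_sub, inner_sub_left]
    linarith

theorem memLp_of_energyNorm (hab : a < b) {T : ℝ} {w : ℝ → DomE a b μ}
    (hw : AEStronglyMeasurable w (volume.restrict (Ioo 0 T)))
    (hE : eLpNorm (fun t => energyNorm (w t : H01 a b)) 2 (volume.restrict (Ioo 0 T)) ≠ ⊤) :
    MemLp w 2 (volume.restrict (Ioo 0 T)) := by
  have h1 : MemLp (fun t => energyNorm (w t : H01 a b)) 2 (volume.restrict (Ioo 0 T)) :=
    ⟨(continuous_energyNorm.comp continuous_subtype_val).comp_aestronglyMeasurable hw, hE.lt_top⟩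
  refine h1.of_le_mul (c := Real.sqrt ((b - a) ^ 2 + 1)) hw (Eventually.of_forall fun t => ?_)
  rw [Real.norm_of_nonneg (show 0 ≤ energyNorm (w t : H01 a b) from Real.sqrt_nonneg _)]
  exact norm_le_energyNorm hab _

/-- Cauchy-Schwarz in time, the source of `√T`. -/
theorem ofReal_integral_energyNorm_le {T : ℝ} (hT : 0 < T) {w : ℝ → DomE a b μ}
    (hw : AEStronglyMeasurable w (volume.restrict (Ioo 0 T))) :
    ENNReal.ofReal (∫ s in Ioo 0 T, energyNorm (w s : H01 a b))
      ≤ ENNReal.ofReal (Real.sqrt T)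
        * eLpNorm (fun t => energyNorm (w t : H01 a b)) 2 (volume.restrict (Ioo 0 T)) := by
  have hm : AEStronglyMeasurable (fun t => energyNorm (w t : H01 a b))
      (volume.restrict (Ioo 0 T)) :=
    (continuous_energyNorm.comp continuous_subtype_val).comp_aestronglyMeasurable hw
  have h1 := eLpNorm_le_eLpNorm_mul_rpow_measure_univ (p := 1) (q := 2) (by norm_num) hm
  have h2 : ENNReal.ofReal (∫ s in Ioo 0 T, energyNorm (w s : H01 a b))
      ≤ eLpNorm (fun t => energyNorm (w t : H01 a b)) 1 (volume.restrict (Ioo 0 T)) := by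
    rw [eLpNorm_one_eq_lintegral_enorm]
    refine le_trans ?_ (enorm_integral_le_lintegral_enorm _)
    rw [← ofReal_norm]
    exact ENNReal.ofReal_le_ofReal (Real.le_norm_self _)
  refine h2.trans (h1.trans (le_of_eq ?_))
  rw [mul_comm, Measure.restrict_apply_univ, Real.volume_Ioo, sub_zero, Real.sqrt_eq_rpow,
    ENNReal.ofReal_rpow_of_pos hT]
  norm_num

end FractalWave

/-! ### The error bound with its constant. -/

open FractalWave
theorem theorem5p5 (a b : ℝ) (hab : a < b)
    (μ : Measure ℝ) [IsFiniteMeasure μ] [NullSingletonClass μ] (hsupp : μ.support = Set.Icc a b)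
    (q : ℕ) (s c p : Fin q → ℝ) (hμ : IsSelfSimilar s c p μ)
    (N : ℕ) (r : ℝ) (hr : 0 < r ∧ r < 1) (n : Fin N → ℕ) (hn : ∀ j, 1 ≤ n j) (d : Fin N → ℝ)
    (hid : SecondOrderIdentities μ (auxMap r n d)) (hosc : OpenSetCondition (auxMap r n d))
    (ρ : ℝ) (hρ : IsGreatest (Set.range fun j => r ^ n j) ρ) :
    ∃ C : ℝ, 0 < C ∧
      ∀ (T : ℝ), 0 < T →
      ∀ (g h : DomE a b μ)
        (u : ℝ → DomE a b μ) (u₁ : ℝ → Lp ℝ 2 μ) (u₂ : ℝ → StrongDual ℝ (DomE a b μ)),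
        IsWeakSolution a b μ T 0 g (embed a b μ h) u u₁ u₂ →
      ∀ m : ℕ, 1 ≤ m →
      ∀ β : ℕ → ℝ → ℝ,
        IsFEMSolution a b μ T (nodeSet (auxMap r n d) a b m)
          (contRep a b (g : H01 a b)) (contRep a b (h : H01 a b)) β →
      ∀ t ∈ Set.Icc 0 T,
        eLpNorm (fun x =>
            ritz (nodeSet (auxMap r n d) a b m) (contRep a b (u t : H01 a b)) x
              - femFun (nodeSet (auxMap r n d) a b m) β t x) 2 μ
          ≤ ENNReal.ofReal (C * Real.sqrt T * ρ ^ ((m : ℝ) / 2)) * normL2Dom T u₂ := by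
  have hprob : IsProbabilityMeasure μ := hμ.isProbability
  have hcov : Icc a b ⊆ ⋃ j, auxMap r n d j '' Icc a b := hsupp ▸ hid.support_subset
  have hρ0 : 0 < ρ := by
    obtain ⟨j, hj⟩ := hρ.1
    exact hj ▸ pow_pos hr.1 _
  have hba : 0 < b - a := sub_pos.2 hab
  -- The 2 is from the energy estimate; one `√(b - a)` bounds the supremum by the energy norm, the
  -- other comes from the mesh width `ρ^m (b - a)`.
  refine ⟨2 * (b - a), by positivity, ?_⟩
  intro T hT g h u u₁ u₂ hu m _ β hβ t ht
  have hV := isMesh_nodeSet hab hr.1 hosc hcov (fun j => hρ.2 ⟨j, rfl⟩) m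
  have hc : 0 < 2 * (b - a) * Real.sqrt T * ρ ^ ((m : ℝ) / 2) := by positivity
  have hc0 : ENNReal.ofReal (2 * (b - a) * Real.sqrt T * ρ ^ ((m : ℝ) / 2)) ≠ 0 :=
    (ENNReal.ofReal_pos.2 hc).ne'
  -- A nonzero finite factor passes through the infimum, so the bound is proved for each
  -- representative `w`. If there is none, the infimum is `∞`.
  simp only [normL2Dom, ENNReal.mul_iInf_of_ne hc0 ENNReal.ofReal_ne_top]
  refine le_iInf fun w => le_iInf fun hw => le_iInf fun hwu => ?_
  rcases eq_or_ne (eLpNorm (fun t => energyNorm (w t : H01 a b)) 2 (volume.restrict (Ioo 0 T))) ⊤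
    with hE | hE
  · rw [hE, ENNReal.mul_top hc0]
    exact le_top
  have hwi : IntegrableOn w (Ioo 0 T) := (memLp_of_energyNorm hab hw hE).integrable (by norm_num)
  have hpt := abs_ritz_sub_femFun_le hab hsupp hV hT hu hβ hwi hwu ht
  have hB : Real.sqrt (b - a) *
      (2 * ∫ s in Ioo 0 T, Real.sqrt (ρ ^ m * (b - a)) * energyNorm (w s : H01 a b))
      = 2 * (b - a) * ρ ^ ((m : ℝ) / 2) * ∫ s in Ioo 0 T, energyNorm (w s : H01 a b) := by
    have h1 : Real.sqrt (ρ ^ m) = ρ ^ ((m : ℝ) / 2) := by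
      rw [Real.sqrt_eq_rpow, ← Real.rpow_natCast, ← Real.rpow_mul hρ0.le]
      ring_nf
    rw [integral_const_mul, Real.sqrt_mul (by positivity), h1]
    calc _ = 2 * (Real.sqrt (b - a) * Real.sqrt (b - a)) * ρ ^ ((m : ℝ) / 2)
          * ∫ s in Ioo 0 T, energyNorm (w s : H01 a b) := by ring
      _ = _ := by rw [Real.mul_self_sqrt hba.le]
  rw [hB] at hpt
  simp only [← Real.norm_eq_abs] at hpt
  calc _ ≤ ENNReal.ofReal (2 * (b - a) * ρ ^ ((m : ℝ) / 2)
          * ∫ s in Ioo 0 T, energyNorm (w s : H01 a b)) := by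
        -- A uniform bound passes to the `L²_μ` norm because μ has mass one.
        have := eLpNorm_le_of_ae_bound (p := 2) (μ := μ) (Eventually.of_forall hpt)
        simpa using this
    _ ≤ ENNReal.ofReal (2 * (b - a) * ρ ^ ((m : ℝ) / 2)) * (ENNReal.ofReal (Real.sqrt T)
        * eLpNorm (fun t => energyNorm (w t : H01 a b)) 2 (volume.restrict (Ioo 0 T))) := by
        rw [ENNReal.ofReal_mul (by positivity)]
        gcongr
        exact ofReal_integral_energyNorm_le hT hw
    _ = _ := by
        rw [← mul_assoc, ← ENNReal.ofReal_mul (by positivity)]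
        congr 2
        ring
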